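/- **Setting.** A pentapod with linear platform consists of five platform points $m_1,\dots,m_5$ on a line $\mathsf p$, with arc-length coordinates $\alpha_1,\dots,\alpha_5\in\mathbb R$, and five base points $\mathsf M_1,\dots,\mathsf M_5\in\mathbb R^3$. *Configurations* are described by motion parameters $(n_0:x_0:x_1:x_2:x_3:y_0:y_1:y_2:y_3)$ over $\mathbb C$ subject to $$\sum x_i^2=x_0^2,\qquad \sum y_i^2=8x_0n_0,\qquad \sum x_iy_i=x_0y_0 ;$$ for $x_0=1$ the point of $\mathsf p$ with coordinate $a$ is placed at $-a\,(x_1,x_2,x_3)-(y_1,y_2,y_3)$. On these parameters the following conditions are linear. * Sphere condition $\Lambda$ of a point $a$ of $\mathsf p$, centre $M$ and radius $R$: $\tfrac12(a^2+|M|^2-R^2)x_0+a\,M\!\cdot\! x+a\,y_0+M\!\cdot\! y+4n_0=0$. * Darboux condition $\Omega$ of a point $a$ of $\mathsf p$ and a direction $D$: $p\,x_0+a\,D\!\cdot\! x+D\!\cdot\! y=0$. * Mannheim condition $\Pi$ of a base point $M$: $p\,x_0+M\!\cdot\! x+y_0=0$. All dot products are bilinear. A *self-motion over $\mathbb C$*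 for given leg parameters is a non-constant holomorphic curve of configurations with $x_0=1$ satisfying all five leg conditions. A point $(u_0:u_1)$ of the projective closure of $\mathsf p$ and a point $(q_0:q_1:q_2:q_3)$ of complex projective 3-space *correspond* if the vector $(u_iq_j)_{i,j}\in\mathbb C^8$ is a linear combination of the five such vectors of the pairs $\big((1:\alpha_i),(1:\mathsf M_i)\big)$. (Up to fixed numerical factors, this vector consists of the coefficients of the leg condition of that pair, without the coefficient of $x_0$.) The pentapod is of *Type 1* if * it is not architecturally singular, i.e. its $5\times6$ matrix of Plücker coordinates of the leg lines does not have rank $<5$ in every real pose; * no three platform points coincide; if two platform points coincide, the other three base points are not collinear; no four base points are collinear; * the base points are not coplanar, and no affine map $\mathbb R^3\to\mathsf p$ sends every $\mathsf M_i$ to $m_i$; * the correspondence is the graph of a bijection $\sigma$ from the projective line onto an irreducible cubic space curve $\mathsf s$, given by four linearly independent real binary cubic forms. It satisfies the *Duporcq condition* if $\mathsf s$ is a straight cubic circle, i.e. the ideal points of $\mathsf s$ are exactly the ideal point of one real direction $d\ne0$ and the two cyclic points of the planes orthogonal to $d$. **Theorem.** Let a pentapod of Type 1 satisfying the Duporcq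 condition be given. 1. It has a one-parameter family of self-motions over $\mathbb C$: the set of squared leg lengths $(\rho_1,\dots,\rho_5)\in\mathbb C^5$ that admit a self-motion is a complex affine line $\{\rho^0+s\,w: s\in\mathbb C\}$ with $\rho^0,w\in\mathbb R^5$ and $w\neq0$. 2. Choose any real finite pair $(m,\mathsf M)$ of corresponding points as origins of the moving frame (whose first axis is $\mathsf p$) and the fixed frame. Then the fixed axes can be rotated so that, for some $a_2,a_3=\overline{a_2}\in\mathbb C$ and $a_4,A_5,B_5,C_5\in\mathbb R$, the points $a_2,a_3,a_4$ of $\mathsf p$ correspond to the ideal points in directions $(1,-i,0)$, $(1,i,0)$, $(0,0,1)$, and the ideal point of $\mathsf p$ corresponds to $(A_5,B_5,C_5)$. 3. In every such coordinatization, for all squared leg lengths the five sphere conditions define the same configuration set as five conditions $\Lambda_1,\Omega_2,\Omega_3,\Omega_4,\Pi_5$ with suitable parameters $(R_1,p_2,p_3,p_4,p_5)\in\mathbb C^5$, and conversely. Here $\Lambda_1$ is the sphere condition with both points at the origins and radius $R_1$; $\Omega_2,\Omega_3,\Omega_4$ are the Darboux conditions of $a_2,a_3,a_4$ with the above directions and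 parameters $p_2,p_3,p_4$; and $\Pi_5$ is the Mannheim condition of $(A_5,B_5,C_5)$ with parameter $p_5$. Moreover $a_2\ne a_4\ne a_3$, and for $(R_1,p_2,\dots,p_5)\in\mathbb C^5$ the conditions $\Lambda_1,\Omega_2,\Omega_3,\Omega_4,\Pi_5$ admit a self-motion over $\mathbb C$ if and only if $$p_2=-\frac{A_5(a_2a_3-a_4^2)-i(a_2a_3-a_4^2)B_5}{(a_3-a_4)^2},\quad p_3=-\frac{A_5(a_2a_3-a_4^2)+i(a_2a_3-a_4^2)B_5}{(a_2-a_4)^2},\quad p_4=\frac{C_5(a_2a_3-a_4^2)}{(a_2-a_4)(a_3-a_4)}$$ and $$(a_2-a_4)^2(a_3-a_4)^2\big[2(a_2a_3-a_4^2)p_5-(a_2+a_3-2a_4)R_1^2-(2a_2a_3-a_2a_4-a_3a_4)a_4\big]+(a_2a_3-a_4^2)^2(a_2+a_3-2a_4)(A_5^2+B_5^2+C_5^2)=0 .$$ -/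

import Mathlib

open Matrix

/-- A pentapod with linear platform: `a i` is the coordinate of the `i`-th platform anchor point
on the line `p` (an arc-length coordinate), `M i` are the Cartesian coordinates of the `i`-th base
anchor point in the fixed frame. The leg lengths are not part of the geometry. -/
structure LinearPentapod where
  a : Fin 5 → ℝ
  M : Fin 5 → Fin 3 → ℝ

namespace Pentapod

/-! ### Motion parameters

A vector `v : Fin 9 → ℂ` holds the homogeneous motion parameters
`(n₀ : x₀ : x₁ : x₂ : x₃ : y₀ : y₁ : y₂ : y₃)`. For `x₀ = 1` the point with coordinate `a` on the
line `p` is placed at `-a x - y`. -/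

/-- The coordinate `n₀`. -/
def n0 (v : Fin 9 → ℂ) : ℂ := v 0
/-- The coordinate `x₀`. -/
def x0 (v : Fin 9 → ℂ) : ℂ := v 1
/-- The vector `(x₁, x₂, x₃)`. -/
def xv (v : Fin 9 → ℂ) : Fin 3 → ℂ := ![v 2, v 3, v 4]
/-- The coordinate `y₀`. -/
def y0 (v : Fin 9 → ℂ) : ℂ := v 5
/-- The vector `(y₁, y₂, y₃)`. -/
def yv (v : Fin 9 → ℂ) : Fin 3 → ℂ := ![v 6, v 7, v 8]

/-- The (complex) image variety of the kinematic mapping, given by the quadrics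
`Φ₁, Φ₂, Φ₃`. -/
def imageVariety : Set (Fin 9 → ℂ) :=
  {v | xv v ⬝ᵥ xv v - x0 v ^ 2 = 0 ∧ yv v ⬝ᵥ yv v - 8 * x0 v * n0 v = 0 ∧
    xv v ⬝ᵥ yv v - x0 v * y0 v = 0}

/-- Left-hand side of the sphere condition: the point `a` of `p` lies on the sphere with centre `M`
and squared radius `ρ`. -/
noncomputable def sphereForm (a : ℂ) (M : Fin 3 → ℂ) (ρ : ℂ) (v : Fin 9 → ℂ) : ℂ :=
  1 / 2 * (a ^ 2 + M ⬝ᵥ M - ρ) * x0 v + a * (M ⬝ᵥ xv v) + a * y0 v + M ⬝ᵥ yv v + 4 * n0 v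

/-- Left-hand side of the Darboux condition: the point `a` of `p` moves in a plane orthogonal to the
direction `D`; the position of the plane is given by `p`. -/
def darbouxForm (a : ℂ) (D : Fin 3 → ℂ) (p : ℂ) (v : Fin 9 → ℂ) : ℂ :=
  p * x0 v + a * (D ⬝ᵥ xv v) + D ⬝ᵥ yv v

/-- Left-hand side of the Mannheim condition: a plane of the moving system orthogonal to the line
slides through the base point `M`; the position of the plane is given by `p`. -/
def mannheimForm (M : Fin 3 → ℂ) (p : ℂ) (v : Fin 9 → ℂ) : ℂ :=
  p * x0 v + M ⬝ᵥ xv v + y0 v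

/-- A configuration set contains a self-motion over `ℂ`: a non-constant holomorphic curve of
configurations that correspond to poses (`x₀ ≠ 0`, normalized by `x₀ = 1`). -/
def HasSelfMotion (C : Set (Fin 9 → ℂ)) : Prop :=
  ∃ γ : ℂ → Fin 9 → ℂ, AnalyticOnNhd ℂ γ (Metric.ball 0 1) ∧
    (∀ t ∈ Metric.ball (0 : ℂ) 1, γ t ∈ C ∧ x0 (γ t) = 1) ∧
    ∃ t ∈ Metric.ball (0 : ℂ) 1, γ t ≠ γ 0

/-- Complex configuration set cut out by the sphere condition of `(m₁, M₁) = (0, 0)` with radius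
`R₁`, the Darboux conditions of `(a₂, (1,-i,0))`, `(a₃, (1,i,0))`, `(a₄, (0,0,1))`
and the Mannheim condition of the base point `M₅`. -/
noncomputable def normalConfigurations (a₂ a₃ : ℂ) (a₄ A₅ B₅ C₅ : ℝ) (R₁ p₂ p₃ p₄ p₅ : ℂ) :
    Set (Fin 9 → ℂ) :=
  {v | v ∈ imageVariety ∧
    sphereForm 0 0 (R₁ ^ 2) v = 0 ∧
    darbouxForm a₂ ![1, -Complex.I, 0] p₂ v = 0 ∧
    darbouxForm a₃ ![1, Complex.I, 0] p₃ v = 0 ∧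
    darbouxForm a₄ ![0, 0, 1] p₄ v = 0 ∧
    mannheimForm ![(A₅ : ℂ), B₅, C₅] p₅ v = 0}

/-- The cubic form-vector with coefficient matrix `G` at the homogeneous parameter `(p₀ : p₁)`. -/
def cubicPoint (G : Matrix (Fin 4) (Fin 4) ℝ) (p : Fin 2 → ℂ) : Fin 4 → ℂ :=
  fun j => ∑ k : Fin 4, (G j k : ℂ) * p 0 ^ (3 - (k : ℕ)) * p 1 ^ (k : ℕ)

/-- Homogeneous coordinates `(1 : m)` of the finite point `m` of the line. -/
def finitePoint₁ (m : ℂ) : Fin 2 → ℂ := ![1, m]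
/-- Homogeneous coordinates `(1 : A : B : C)` of a finite point of the base space. -/
def finitePoint₃ (M : Fin 3 → ℂ) : Fin 4 → ℂ := ![1, M 0, M 1, M 2]
/-- Homogeneous coordinates `(0 : A : B : C)` of the ideal point in direction `D`. -/
def idealPoint₃ (D : Fin 3 → ℂ) : Fin 4 → ℂ := ![0, D 0, D 1, D 2]

end Pentapod

namespace LinearPentapod

open Pentapod

variable (P : LinearPentapod)

/-- Base anchor points, as complex points. -/
def Mc (i : Fin 5) : Fin 3 → ℂ := fun k => (P.M i k : ℂ)

/-- Complex configuration set of the pentapod with squared leg lengths `ρ i`. -/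
def configurations (ρ : Fin 5 → ℂ) : Set (Fin 9 → ℂ) :=
  {v | v ∈ imageVariety ∧ ∀ i, sphereForm (P.a i) (P.Mc i) (ρ i) v = 0}

/-- Jacobian in the pose in which the line has direction `u` and its point with coordinate `0` is
at `t`: its rows are the Plücker coordinates of the carrier lines of the legs. -/
def jacobian (u t : Fin 3 → ℝ) : Matrix (Fin 5) (Fin 3 ⊕ Fin 3) ℝ :=
  Matrix.of fun i =>
    Sum.elim (P.a i • u + t - P.M i) (crossProduct (P.M i) (P.a i • u + t))

/-- Architecturally singular: the Jacobian has rank less than five in every pose. -/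
def ArchitecturallySingular : Prop :=
  ∀ u t : Fin 3 → ℝ, u ⬝ᵥ u = 1 → (P.jacobian u t).rank < 5

/-- The class of non-architecturally singular pentapods with linear platform such that no three
platform anchor points coincide; if two platform anchor points coincide, the other three base
anchor points are not collinear; and no four base anchor points are collinear. -/
structure InClassP : Prop where
  not_singular : ¬ P.ArchitecturallySingular
  no_three : ∀ i j k : Fin 5, i ≠ j → i ≠ k → j ≠ k → ¬ (P.a i = P.a j ∧ P.a j = P.a k)
  of_two : ∀ i j : Fin 5, i ≠ j → P.a i = P.a j → ¬ Collinear ℝ (P.M '' {i, j}ᶜ)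
  no_four : ∀ i : Fin 5, ¬ Collinear ℝ (P.M '' {i}ᶜ)

/-- The affine relation: an affine map from the base space to the line maps `M i` to `m i`. -/
def AffineRelation : Prop :=
  ∃ κ : (Fin 3 → ℝ) →ᵃ[ℝ] ℝ, ∀ i, κ (P.M i) = P.a i

/-- The correspondence implied by singular-invariant leg-replacements, in homogeneous coordinates:
the point `p` of the projective line and the point `q` of projective space correspond if the
coefficients of the motion parameters other than `x₀` in the leg condition of `(p, q)`,
which are the products `p i * q j`, are a linear combination of those of the five given legs. -/
def Corresponds (p : Fin 2 → ℂ) (q : Fin 4 → ℂ) : Prop :=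
  vecMulVec p q ∈ Submodule.span ℂ (Set.range fun i : Fin 5 =>
    vecMulVec (finitePoint₁ (P.a i)) (finitePoint₃ (P.Mc i)))

/-- Type 1: a non-planar pentapod of the class above, without the affine relation, for which the
correspondence is a bijection `σ` of the projective line onto an irreducible cubic space curve
(a twisted cubic, parametrized by four linearly independent cubic forms). -/
structure IsTypeOne : Prop where
  inClassP : P.InClassP
  nonplanar : ¬ Coplanar ℝ (Set.range P.M)
  not_affine : ¬ P.AffineRelation
  cubic : ∃ G : Matrix (Fin 4) (Fin 4) ℝ, G.det ≠ 0 ∧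
    ∀ (p : Fin 2 → ℂ) (q : Fin 4 → ℂ), p ≠ 0 → q ≠ 0 →
      (P.Corresponds p q ↔ ∃ c : ℂ, q = c • cubicPoint G p)

/-- The Duporcq condition: the cubic is a straight cubic circle, i.e. its ideal points are the
ideal point of a real direction `d` and the two cyclic points of the planes orthogonal to `d`. -/
def Duporcq : Prop :=
  ∃ d : Fin 3 → ℝ, d ≠ 0 ∧ ∀ w : Fin 3 → ℂ, w ≠ 0 →
    ((∃ p : Fin 2 → ℂ, p ≠ 0 ∧ P.Corresponds p (idealPoint₃ w)) ↔
      ((∃ c : ℂ, w = c • (fun k => (d k : ℂ))) ∨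
        (w ⬝ᵥ w = 0 ∧ w ⬝ᵥ (fun k => (d k : ℂ)) = 0)))

/-- The pentapod in new Cartesian frames: the origin of the moving frame is the point `m` of the
line, the origin of the fixed frame is `M₀`, and the fixed axes are rotated by `O`. -/
def changeFrames (m : ℝ) (M₀ : Fin 3 → ℝ) (O : Matrix (Fin 3) (Fin 3) ℝ) : LinearPentapod where
  a i := P.a i - m
  M i := O *ᵥ (P.M i - M₀)

/-- The coordinatization: the origins `m₁`, `M₁` correspond to each other; the points `m₂, m₃, m₄`
of the line with coordinates `a₂`, `a₃ = conj a₂`, `a₄` correspond to the ideal points in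
directions `(1,-i,0)`, `(1,i,0)`, `(0,0,1)`; the ideal point of the line corresponds to
`M₅ = (A₅, B₅, C₅)`. -/
structure Coordinatized (a₂ a₃ : ℂ) (a₄ A₅ B₅ C₅ : ℝ) : Prop where
  conj : a₃ = starRingEnd ℂ a₂
  leg₁ : P.Corresponds (finitePoint₁ 0) (finitePoint₃ 0)
  leg₂ : P.Corresponds (finitePoint₁ a₂) (idealPoint₃ ![1, -Complex.I, 0])
  leg₃ : P.Corresponds (finitePoint₁ a₃) (idealPoint₃ ![1, Complex.I, 0])
  leg₄ : P.Corresponds (finitePoint₁ a₄) (idealPoint₃ ![0, 0, 1])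
  leg₅ : P.Corresponds ![0, 1] (finitePoint₃ ![(A₅ : ℂ), B₅, C₅])

end LinearPentapod

/-! Apart from its `x₀` term, a leg condition is a linear functional with coefficients `u_i q_j`.
The five normalized pairs have independent coefficient vectors, all lying in the span of the given
five, so the spans agree. An invertible matrix (`legMatrix`) then translates the constant terms of
one set of conditions into those of the other (`configurations_eq`).

For the normalized conditions put ξ = x₁ - i x₂, ξ' = x₁ + i x₂, z = x₃. When x₀ = 1, the five
linear conditions fix n₀ and make y₀, y affine functions of x. A pose is thus a point of ξ ξ' + z² =
1 on which Φ₂ and Φ₃ also vanish. Modulo this sphere these two become k z² + linear = 0 and k' z² +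
linear = 0, with k = a₄² - a₂a₃ and k' = a₄ - (a₂ + a₃)/2. They share a nonconstant curve on the
sphere exactly when they are proportional (`quadrics_proportional`, `exists_curve`, joined in
`hasSelfMotion_normal_iff_proportional`).

Comparing coefficients determines p₂, p₃, p₄ and leaves one equation that is linear in p₅ and R₁²
(`proportional_iff`). Since a₃ is the conjugate of a₂, that equation is real; it is nontrivial
because a₂ ≠ a₄. Its solution line is carried by the leg matrix to the line of squared leg lengths
(`exists_sqLength_line`).

The Type 1 hypotheses enter through nonvanishing: single-valuedness of the correspondence and
noncoplanarity give the inequalities in `nondegenerate`, and the absence of an affine relation makes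
the ideal point of the line correspond to a finite base point. -/

namespace Pentapod

/-! ### Curves on the unit sphere -/

/-- A function on a preconnected set that satisfies a nontrivial polynomial equation is constant. -/
theorem eq_of_polynomial_eq_zero {U : Set ℂ} (hU : IsPreconnected U) {f : ℂ → ℂ}
    (hf : ContinuousOn f U) {q : Polynomial ℂ} (hq : q ≠ 0) (h : ∀ t ∈ U, q.eval (f t) = 0) :
    ∀ s ∈ U, ∀ t ∈ U, f s = f t := by
  intro s hs t ht
  by_contra hne
  have hinf : (f '' U).Infinite :=
    (hU.image f hf).infinite_of_nontrivial ⟨f s, ⟨s, hs, rfl⟩, f t, ⟨t, ht, rfl⟩, hne⟩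
  refine hinf ((q.roots.toFinset.finite_toSet).subset ?_)
  rintro _ ⟨u, hu, rfl⟩
  simpa [hq] using h u hu

/-- A nonconstant function on a preconnected set satisfies no nontrivial quartic equation. -/
theorem quartic_coeffs_eq_zero {U : Set ℂ} (hU : IsPreconnected U) {f : ℂ → ℂ}
    (hf : ContinuousOn f U) (hne : ∃ s ∈ U, ∃ t ∈ U, f s ≠ f t) {a b c d e : ℂ}
    (h : ∀ t ∈ U, a * f t ^ 4 + b * f t ^ 3 + c * f t ^ 2 + d * f t + e = 0) :
    a = 0 ∧ b = 0 ∧ c = 0 ∧ d = 0 ∧ e = 0 := by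
  open Polynomial in
  set q : Polynomial ℂ := C a * X ^ 4 + C b * X ^ 3 + C c * X ^ 2 + C d * X + C e with hqdef
  have hq : q = 0 := by
    by_contra hq
    obtain ⟨s, hs, t, ht, hst⟩ := hne
    exact hst (eq_of_polynomial_eq_zero hU hf hq (fun t ht => by simpa [hqdef] using h t ht)
      s hs t ht)
  have hc : ∀ n, q.coeff n = 0 := by simp [hq]
  refine ⟨?_, ?_, ?_, ?_, ?_⟩
  · simpa [hqdef, Polynomial.coeff_X, Polynomial.coeff_C] using hc 4
  · simpa [hqdef, Polynomial.coeff_X, Polynomial.coeff_C] using hc 3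
  · simpa [hqdef, Polynomial.coeff_X, Polynomial.coeff_C] using hc 2
  · simpa [hqdef, Polynomial.coeff_X, Polynomial.coeff_C] using hc 1
  · simpa [hqdef, Polynomial.coeff_X, Polynomial.coeff_C] using hc 0

/-- On a curve of constant third coordinate in the quadric `ξ ξ' + z² = 1` that satisfies two linear
equations not both free of `ξ`, the coordinate `ξ` is constant. -/
theorem isotropic_coordinate_const {U : Set ℂ} (hU : IsPreconnected U) {ξ ξ' : ℂ → ℂ}
    (hξ : ContinuousOn ξ U) {m b b' c d d' g : ℂ}
    (hS : ∀ t ∈ U, ξ t * ξ' t = m)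
    (h₂ : ∀ t ∈ U, b * ξ t + b' * ξ' t + c = 0) (h₃ : ∀ t ∈ U, d * ξ t + d' * ξ' t + g = 0)
    (hbd : ¬ (b = 0 ∧ d = 0)) : ∀ s ∈ U, ∀ t ∈ U, ξ s = ξ t := by
  by_contra! hne
  refine hbd ⟨(quartic_coeffs_eq_zero hU hξ hne (a := 0) (b := 0) (c := b) (d := c)
    (e := b' * m) fun t ht => ?_).2.2.1, (quartic_coeffs_eq_zero hU hξ hne (a := 0) (b := 0)
    (c := d) (d := g) (e := d' * m) fun t ht => ?_).2.2.1⟩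
  · linear_combination ξ t * h₂ t ht - b' * hS t ht
  · linear_combination ξ t * h₃ t ht - d' * hS t ht

/-- A curve with nonconstant third coordinate in the quadric `ξ ξ' + z² = 1` that lies on two
quadrics `k z² + linear` lies in no plane with a nonzero coefficient at `ξ`. -/
theorem plane_coeff_eq_zero {U : Set ℂ} (hU : IsPreconnected U) {ξ ξ' z : ℂ → ℂ}
    (hz : ContinuousOn z U) (hne : ∃ s ∈ U, ∃ t ∈ U, z s ≠ z t)
    {k b b' e c k' d d' f g : ℂ}
    (hS : ∀ t ∈ U, ξ t * ξ' t + z t ^ 2 = 1)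
    (h₂ : ∀ t ∈ U, k * z t ^ 2 + b * ξ t + b' * ξ' t + e * z t + c = 0)
    (h₃ : ∀ t ∈ U, k' * z t ^ 2 + d * ξ t + d' * ξ' t + f * z t + g = 0)
    (hk : ¬ (k = 0 ∧ k' = 0)) (hef : ¬ (e = 0 ∧ f = 0)) :
    k' * b - k * d = 0 := by
  by_contra hl
  set l := k' * b - k * d
  set μ := k' * b' - k * d' with hμ
  set ν := k' * e - k * f with hν
  set τ := k' * c - k * g with hτ
  -- Eliminating z² between the two quadrics leaves the plane l ξ + μ ξ' + ν z + τ = 0, which l ≠ 0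
  -- allows to solve for ξ.
  have hL : ∀ t ∈ U, ξ t = -(μ * ξ' t + ν * z t + τ) / l := fun t ht => by
    rw [eq_div_iff hl]
    linear_combination k' * h₂ t ht - k * h₃ t ht
  -- a combination with nonzero quadratic coefficient and without `ξ`
  obtain ⟨K, B, E, C, hK, hQ⟩ : ∃ K B E C : ℂ, K ≠ 0 ∧
      ∀ t ∈ U, K * z t ^ 2 + B * ξ' t + E * z t + C = 0 := by
    by_cases h0 : k = 0
    · refine ⟨k', d' - d * μ / l, f - d * ν / l, g - d * τ / l, fun h => hk ⟨h0, h⟩,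
        fun t ht => ?_⟩
      have := h₃ t ht
      rw [hL t ht] at this
      linear_combination this
    · refine ⟨k, b' - b * μ / l, e - b * ν / l, c - b * τ / l, h0, fun t ht => ?_⟩
      have := h₂ t ht
      rw [hL t ht] at this
      linear_combination this
  have hB : B ≠ 0 := by
    rintro rfl
    exact hK (quartic_coeffs_eq_zero hU hz hne (a := 0) (b := 0) (c := K) (d := E) (e := C)
      fun t ht => by linear_combination hQ t ht).2.2.1
  have hξ' : ∀ t ∈ U, ξ' t = -(K * z t ^ 2 + E * z t + C) / B := fun t ht => by
    rw [eq_div_iff hB]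
    linear_combination hQ t ht
  have hS' : ∀ t ∈ U, -(μ * ξ' t + ν * z t + τ) * ξ' t + l * z t ^ 2 - l = 0 := fun t ht => by
    have := hS t ht
    rw [hL t ht] at this
    field_simp at this
    linear_combination this
  -- Now ξ' is a quadratic polynomial in z, so the sphere gives a quartic in the nonconstant z, and
  -- all its coefficients vanish. The top one is -μ K²; once μ = 0, the cubic one is ν B K.
  have hμ0 : μ = 0 := by
    have := (quartic_coeffs_eq_zero hU hz hne (a := -μ * K ^ 2)
      (b := -μ * (2 * K * E) + ν * B * K)
      (c := -μ * (2 * K * C + E ^ 2) + ν * B * E + τ * B * K + l * B ^ 2)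
      (d := -μ * (2 * E * C) + ν * B * C + τ * B * E) (e := -μ * C ^ 2 + τ * B * C - l * B ^ 2)
      fun t ht => ?_).1
    · simpa [hK] using this
    · have := hS' t ht
      rw [hξ' t ht] at this
      field_simp at this
      linear_combination this
  have hν0 : ν = 0 := by
    have := (quartic_coeffs_eq_zero hU hz hne (a := 0)
      (b := ν * B * K) (c := ν * B * E + τ * B * K + l * B ^ 2)
      (d := ν * B * C + τ * B * E) (e := τ * B * C - l * B ^ 2)
      fun t ht => ?_).2.1
    · simpa [hK, hB] using this
    · have := hS' t ht
      rw [hξ' t ht, hμ0] at this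
      field_simp at this
      linear_combination this
  have hL' : ∀ t ∈ U, ξ t = -τ / l := fun t ht => by rw [hL t ht, hμ0, hν0]; ring
  have hτ0 : τ ≠ 0 := by
    intro h0
    refine hl (quartic_coeffs_eq_zero hU hz hne (a := 0) (b := 0) (c := l) (d := 0) (e := -l)
      fun t ht => ?_).2.2.1
    have := hS' t ht
    rw [hμ0, hν0, h0] at this
    linear_combination this
  have hξ'' : ∀ t ∈ U, ξ' t = l * (z t ^ 2 - 1) / τ := fun t ht => by
    rw [eq_div_iff hτ0]
    have := hS' t ht
    rw [hμ0, hν0] at this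
    linear_combination -this
  -- With ξ constant and ξ' a polynomial in z², the only terms of odd degree in z left in the two
  -- quadrics are e z and f z.
  refine hef ⟨(quartic_coeffs_eq_zero hU hz hne (a := 0) (b := 0) (c := k + b' * l / τ) (d := e)
    (e := c - b * τ / l - b' * l / τ) fun t ht => ?_).2.2.2.1,
    (quartic_coeffs_eq_zero hU hz hne (a := 0) (b := 0) (c := k' + d' * l / τ) (d := f)
    (e := g - d * τ / l - d' * l / τ) fun t ht => ?_).2.2.2.1⟩
  · have := h₂ t ht
    rw [hL' t ht, hξ'' t ht] at this
    linear_combination this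
  · have := h₃ t ht
    rw [hL' t ht, hξ'' t ht] at this
    linear_combination this

/-- If a nonconstant curve lies on the quadric `ξ ξ' + z² = 1` and on two quadrics of the form
`k z² + linear`, then these two are proportional. -/
theorem quadrics_proportional {U : Set ℂ} (hU : IsPreconnected U) {ξ ξ' z : ℂ → ℂ}
    (hξ : ContinuousOn ξ U) (hξ' : ContinuousOn ξ' U) (hz : ContinuousOn z U)
    (hne : ∃ s ∈ U, ∃ t ∈ U, ¬ (ξ s = ξ t ∧ ξ' s = ξ' t ∧ z s = z t))
    {k b b' e c k' d d' f g : ℂ}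
    (hS : ∀ t ∈ U, ξ t * ξ' t + z t ^ 2 = 1)
    (h₂ : ∀ t ∈ U, k * z t ^ 2 + b * ξ t + b' * ξ' t + e * z t + c = 0)
    (h₃ : ∀ t ∈ U, k' * z t ^ 2 + d * ξ t + d' * ξ' t + f * z t + g = 0)
    (hk : ¬ (k = 0 ∧ k' = 0)) (hbd : ¬ (b = 0 ∧ d = 0)) (hbd' : ¬ (b' = 0 ∧ d' = 0))
    (hef : ¬ (e = 0 ∧ f = 0)) :
    k' * b = k * d ∧ k' * b' = k * d' ∧ k' * e = k * f ∧ k' * c = k * g := by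
  obtain ⟨s, hs, t, ht, hst⟩ := hne
  by_cases hzc : ∃ s ∈ U, ∃ t ∈ U, z s ≠ z t
  · have e₁ := plane_coeff_eq_zero hU hz hzc hS h₂ h₃ hk hef
    have e₂ := plane_coeff_eq_zero (ξ := ξ') (ξ' := ξ) (b := b') (b' := b) (c := c)
      (d := d') (d' := d) (g := g)
      hU hz hzc (fun t ht => by rw [mul_comm]; exact hS t ht)
      (fun t ht => by linear_combination h₂ t ht) (fun t ht => by linear_combination h₃ t ht) hk hef
    have := quartic_coeffs_eq_zero hU hz hzc (a := 0) (b := 0) (c := 0) (d := k' * e - k * f)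
      (e := k' * c - k * g) fun t ht => by
        linear_combination k' * h₂ t ht - k * h₃ t ht - ξ t * e₁ - ξ' t * e₂
    exact ⟨sub_eq_zero.1 e₁, sub_eq_zero.1 e₂, sub_eq_zero.1 this.2.2.2.1,
      sub_eq_zero.1 this.2.2.2.2⟩
  -- If z is constant, the product ξ ξ' is constant too, and the linear relations fix ξ and ξ' as
  -- well.
  · push Not at hzc
    have hSc : ∀ t ∈ U, ξ t * ξ' t = 1 - z s ^ 2 := fun t ht => by
      rw [hzc s hs t ht]; linear_combination hS t ht
    have h₂' : ∀ t ∈ U, b * ξ t + b' * ξ' t + (k * z s ^ 2 + e * z s + c) = 0 := fun t ht => by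
      rw [hzc s hs t ht]; linear_combination h₂ t ht
    have h₃' : ∀ t ∈ U, d * ξ t + d' * ξ' t + (k' * z s ^ 2 + f * z s + g) = 0 := fun t ht => by
      rw [hzc s hs t ht]; linear_combination h₃ t ht
    exact absurd ⟨isotropic_coordinate_const hU hξ hSc h₂' h₃' hbd s hs t ht,
      isotropic_coordinate_const hU hξ' (b := b') (b' := b) (c := k * z s ^ 2 + e * z s + c)
        (d := d') (d' := d) (g := k' * z s ^ 2 + f * z s + g) (fun t ht => by rw [mul_comm]; exact hSc t ht)
        (fun t ht => by linear_combination h₂' t ht)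
        (fun t ht => by linear_combination h₃' t ht) hbd' s hs t ht,
      hzc s hs t ht⟩ hst

/-- The intersection of `ξ ξ' + z² = 1` and `z² + b ξ + b' ξ' + e z + c = 0` with `b b' ≠ 0`
contains a nonconstant holomorphic curve. -/
theorem exists_curve {b b' : ℂ} (hb : b ≠ 0) (hb' : b' ≠ 0) (e c : ℂ) :
    ∃ ξ ξ' z : ℂ → ℂ, DifferentiableOn ℂ ξ (Metric.ball 0 1) ∧
      DifferentiableOn ℂ ξ' (Metric.ball 0 1) ∧ DifferentiableOn ℂ z (Metric.ball 0 1) ∧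
      (∀ t ∈ Metric.ball (0 : ℂ) 1, ξ t * ξ' t + z t ^ 2 = 1 ∧
        z t ^ 2 + b * ξ t + b' * ξ' t + e * z t + c = 0) ∧
      ∃ t ∈ Metric.ball (0 : ℂ) 1, z t ≠ z 0 := by
  set q : ℂ → ℂ := fun z => z ^ 2 + e * z + c with hq
  -- For given z, the numbers b ξ and b' ξ' have sum -q(z) and product b b' (1 - z²). They are the
  -- roots of a quadratic with discriminant D(z), a monic quartic in z.
  set D : ℂ → ℂ := fun z => q z ^ 2 - 4 * b * b' * (1 - z ^ 2) with hD
  have hDd : Differentiable ℂ D := by fun_prop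
  obtain ⟨z₀, hz₀⟩ : ∃ z₀, D z₀ ≠ 0 := by
    by_contra! h
    refine one_ne_zero (quartic_coeffs_eq_zero (f := id) isPreconnected_univ continuousOn_id
      ⟨0, trivial, 1, trivial, zero_ne_one⟩ (a := 1) (b := 2 * e) (c := e ^ 2 + 2 * c + 4 * b * b')
      (d := 2 * e * c) (e := c ^ 2 - 4 * b * b') fun t _ => ?_).1
    have := h t
    simp only [hD, hq] at this
    simp only [id]
    linear_combination this
  obtain ⟨r, hr⟩ := IsAlgClosed.exists_pow_nat_eq (D z₀) (n := 2) two_pos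
  obtain ⟨ε, hε, hball⟩ : ∃ ε > 0, ∀ z ∈ Metric.ball z₀ ε, D z / D z₀ ∈ Complex.slitPlane := by
    have ho : IsOpen ((fun z => D z / D z₀) ⁻¹' Complex.slitPlane) :=
      Complex.isOpen_slitPlane.preimage (hDd.continuous.div_const _)
    obtain ⟨ε, hε, h⟩ := Metric.isOpen_iff.1 ho z₀ (by simp [div_self hz₀])
    exact ⟨ε, hε, fun z hz => h hz⟩
  set z : ℂ → ℂ := fun t => z₀ + ε * t with hzdef
  -- A holomorphic square root of D along z: near z₀ the quotient D/D(z₀) stays in the slit plane,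
  -- where the principal logarithm is holomorphic, and r² = D(z₀).
  set w : ℂ → ℂ := fun t => r * Complex.exp (Complex.log (D (z t) / D z₀) / 2) with hw
  have hzball : ∀ t ∈ Metric.ball (0 : ℂ) 1, z t ∈ Metric.ball z₀ ε := fun t ht => by
    simp only [mem_ball_zero_iff] at ht
    simp only [hzdef, Metric.mem_ball, dist_self_add_left, norm_mul, Complex.norm_real,
      Real.norm_of_nonneg hε.le]
    nlinarith
  have hzd : Differentiable ℂ z := by fun_prop
  have hwd : DifferentiableOn ℂ w (Metric.ball 0 1) := by
    refine DifferentiableOn.const_mul (DifferentiableOn.cexp (DifferentiableOn.div_const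
      (DifferentiableOn.clog ?_ fun t ht => hball _ (hzball t ht)) _)) _
    exact ((hDd.comp hzd).div_const _).differentiableOn
  have hw2 : ∀ t ∈ Metric.ball (0 : ℂ) 1, w t ^ 2 = D (z t) := fun t ht => by
    have h0 := Complex.slitPlane_ne_zero (hball _ (hzball t ht))
    rw [hw]
    simp only
    rw [mul_pow, hr, ← Complex.exp_nat_mul, Nat.cast_ofNat, mul_div_cancel₀ _ two_ne_zero,
      Complex.exp_log h0, mul_div_cancel₀ _ hz₀]
  have hqd : Differentiable ℂ fun t => q (z t) := by fun_prop
  refine ⟨fun t => (-q (z t) - w t) / (2 * b), fun t => (-q (z t) + w t) / (2 * b'), z,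
    ((hqd.neg.differentiableOn.sub hwd).div_const _),
    ((hqd.neg.differentiableOn.add hwd).div_const _), hzd.differentiableOn, fun t ht => ⟨?_, ?_⟩,
    1 / 2, by simp; norm_num, ?_⟩
  · have := hw2 t ht
    simp only [hD] at this
    field_simp
    linear_combination -this
  · simp only [hq]
    field_simp
    ring
  · simp [hzdef, hε.ne']

end Pentapod

namespace Pentapod

/-! ### Self-motions of the normalized conditions -/

/-- Cross-multiplied proportionality becomes an honest common factor because (k, k') ≠ (0, 0).
Applied to each coefficient, it yields one quadric z² + b ξ + b' ξ' + e z + c of which both given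
ones are multiples. -/
theorem exists_common_factor {k k' x y : ℂ} (hk : ¬ (k = 0 ∧ k' = 0)) (h : k' * x = k * y) :
    ∃ b, x = k * b ∧ y = k' * b := by
  by_cases h0 : k = 0
  · have h1 : k' ≠ 0 := fun h1 => hk ⟨h0, h1⟩
    refine ⟨y / k', ?_, by field_simp⟩
    have : x = 0 := by simpa [h0, h1] using h
    simp [h0, this]
  · refine ⟨x / k, by field_simp, ?_⟩
    field_simp
    linear_combination -h

/-- The normalized configurations admit a self-motion if and only if the two quadrics that
they cut out on the unit sphere of directions of the line are proportional. -/
theorem hasSelfMotion_normal_iff_proportional {a₂ a₃ : ℂ} {a₄ A₅ B₅ C₅ : ℝ}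
    (h2 : a₂ ≠ 0) (h3 : a₃ ≠ 0) (h4 : a₄ ≠ 0)
    (hk : ¬ ((a₄ : ℂ) ^ 2 - a₂ * a₃ = 0 ∧ (a₄ : ℂ) - (a₂ + a₃) / 2 = 0))
    (hα : (A₅ : ℂ) + Complex.I * B₅ ≠ 0) (hα' : (A₅ : ℂ) - Complex.I * B₅ ≠ 0) (hC : C₅ ≠ 0)
    (R₁ p₂ p₃ p₄ p₅ : ℂ) :
    HasSelfMotion (normalConfigurations a₂ a₃ a₄ A₅ B₅ C₅ R₁ p₂ p₃ p₄ p₅) ↔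
      (a₄ - (a₂ + a₃) / 2) * (a₂ * p₃) =
        ((a₄ : ℂ) ^ 2 - a₂ * a₃) * (p₃ / 2 - (A₅ + Complex.I * B₅) / 2) ∧
      (a₄ - (a₂ + a₃) / 2) * (a₃ * p₂) =
        ((a₄ : ℂ) ^ 2 - a₂ * a₃) * (p₂ / 2 - (A₅ - Complex.I * B₅) / 2) ∧
      (a₄ - (a₂ + a₃) / 2) * (2 * a₄ * p₄) = ((a₄ : ℂ) ^ 2 - a₂ * a₃) * (p₄ - C₅) ∧
      (a₄ - (a₂ + a₃) / 2) * (p₂ * p₃ + p₄ ^ 2 + a₂ * a₃ - R₁ ^ 2) =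
        ((a₄ : ℂ) ^ 2 - a₂ * a₃) * ((a₂ + a₃) / 2 - p₅) := by
  have hI := Complex.I_mul_I
  have h4' : (a₄ : ℂ) ≠ 0 := by exact_mod_cast h4
  have hC' : (C₅ : ℂ) ≠ 0 := by exact_mod_cast hC
  have hbd : ¬ (a₂ * p₃ = 0 ∧ p₃ / 2 - (A₅ + Complex.I * B₅) / 2 = 0) := by
    rintro ⟨h, h'⟩
    have : p₃ = 0 := by simpa [h2] using h
    subst this
    exact hα (by linear_combination -2 * h')
  have hbd' : ¬ (a₃ * p₂ = 0 ∧ p₂ / 2 - (A₅ - Complex.I * B₅) / 2 = 0) := by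
    rintro ⟨h, h'⟩
    have : p₂ = 0 := by simpa [h3] using h
    subst this
    exact hα' (by linear_combination -2 * h')
  have hef : ¬ (2 * a₄ * p₄ = 0 ∧ p₄ - C₅ = 0) := by
    rintro ⟨h, h'⟩
    have : p₄ = 0 := by simpa [h4'] using h
    subst this
    exact hC' (by linear_combination -h')
  constructor
  · rintro ⟨γ, hγ, hC, t₁, ht₁, hne⟩
    have hcont : ∀ i, ContinuousOn (fun t => γ t i) (Metric.ball 0 1) := fun i =>
      (continuous_apply i).comp_continuousOn hγ.continuousOn
    simp only [normalConfigurations, imageVariety, Set.mem_ofPred_eq, sphereForm, darbouxForm,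
      mannheimForm, n0, x0, xv, y0, yv, dotProduct, Fin.sum_univ_three, cons_val_zero,
      cons_val_one, cons_val, Pi.zero_apply] at hC
    refine quadrics_proportional (U := Metric.ball 0 1)
      (ξ := fun t => γ t 2 - Complex.I * γ t 3) (ξ' := fun t => γ t 2 + Complex.I * γ t 3)
      (z := fun t => γ t 4) (convex_ball _ _).isPreconnected
      ((hcont 2).sub (continuousOn_const.mul (hcont 3)))
      ((hcont 2).add (continuousOn_const.mul (hcont 3))) (hcont 4)
      ⟨t₁, ht₁, 0, by simp, ?_⟩ ?_ ?_ ?_ hk hbd hbd' hef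
    -- A motion with constant direction x is constant, since the linear conditions recover the other
    -- parameters from x.
    · rintro ⟨e₁, e₂, e₃⟩
      apply hne
      obtain ⟨⟨⟨-, -, -⟩, s1, s2, s3, s4, s5⟩, s6⟩ := hC t₁ ht₁
      obtain ⟨⟨⟨-, -, -⟩, r1, r2, r3, r4, r5⟩, r6⟩ := hC 0 (by simp)
      have d2 : γ t₁ 2 = γ 0 2 := by linear_combination (e₁ + e₂) / 2
      have d3 : γ t₁ 3 = γ 0 3 := by
        linear_combination Complex.I * (e₁ - e₂) / 2 + (γ t₁ 3 - γ 0 3) * hI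
      rw [s6] at s1 s2 s3 s4 s5
      rw [r6] at r1 r2 r3 r4 r5
      have f6 : γ t₁ 6 - Complex.I * γ t₁ 7 = γ 0 6 - Complex.I * γ 0 7 := by
        linear_combination s2 - r2 - a₂ * e₁
      have f7 : γ t₁ 6 + Complex.I * γ t₁ 7 = γ 0 6 + Complex.I * γ 0 7 := by
        linear_combination s3 - r3 - a₃ * e₂
      ext i
      fin_cases i
      · change γ t₁ 0 = γ 0 0
        linear_combination (s1 - r1) / 4
      · change γ t₁ 1 = γ 0 1
        rw [s6, r6]
      · exact d2
      · exact d3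
      · exact e₃
      · change γ t₁ 5 = γ 0 5
        linear_combination s5 - r5 - A₅ * d2 - B₅ * d3 - C₅ * e₃
      · change γ t₁ 6 = γ 0 6
        linear_combination (f6 + f7) / 2
      · change γ t₁ 7 = γ 0 7
        linear_combination Complex.I * (f6 - f7) / 2 + (γ t₁ 7 - γ 0 7) * hI
      · change γ t₁ 8 = γ 0 8
        linear_combination s4 - r4 - a₄ * e₃
    · intro t ht
      obtain ⟨⟨⟨s1, -, -⟩, -⟩, s6⟩ := hC t ht
      rw [s6] at s1
      linear_combination s1 - γ t 3 ^ 2 * hI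
    -- Φ₂ with y and n₀ eliminated, minus a₂a₃ times the sphere equation, which removes the ξ ξ'
    -- term.
    · intro t ht
      obtain ⟨⟨⟨u1, u2, u3⟩, s1, s2, s3, s4, s5⟩, s6⟩ := hC t ht
      rw [s6] at u1 u2 u3 s1 s2 s3 s4 s5
      generalize γ t 0 = n, γ t 2 = x1, γ t 3 = x2, γ t 4 = x3, γ t 5 = y0, γ t 6 = y1,
        γ t 7 = y2, γ t 8 = y3 at *
      linear_combination s2 * (p₃ + a₃ * (x1 + Complex.I * x2)) - (y1 - Complex.I * y2) * s3
        + u2 + 2 * s1 + s4 * (p₄ + a₄ * x3) - y3 * s4 - a₂ * a₃ * u1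
        + (a₂ * a₃ * x2 ^ 2 - y2 ^ 2) * hI
    -- Φ₃ in the same way; here (a₂ + a₃)/2 times the sphere equation is removed.
    · intro t ht
      obtain ⟨⟨⟨u1, u2, u3⟩, s1, s2, s3, s4, s5⟩, s6⟩ := hC t ht
      rw [s6] at u1 u2 u3 s1 s2 s3 s4 s5
      generalize γ t 0 = n, γ t 2 = x1, γ t 3 = x2, γ t 4 = x3, γ t 5 = y0, γ t 6 = y1,
        γ t 7 = y2, γ t 8 = y3 at *
      linear_combination ((x1 - Complex.I * x2) * s3 + (x1 + Complex.I * x2) * s2) / 2 + x3 * s4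
        - (a₂ + a₃) / 2 * u1 - u3 - s5 + ((a₂ + a₃) / 2 * x2 ^ 2 + x2 * y2 + B₅ * x2) * hI
  · rintro ⟨e₁, e₂, e₃, e₄⟩
    obtain ⟨b, hb₂, hb₃⟩ := exists_common_factor hk e₁
    obtain ⟨b', hb₂', hb₃'⟩ := exists_common_factor hk e₂
    obtain ⟨e, he₂, he₃⟩ := exists_common_factor hk e₃
    obtain ⟨c, hc₂, hc₃⟩ := exists_common_factor hk e₄
    -- Vanishing of b would kill the ξ coefficient of both quadrics, against the nondegeneracy of A₅
    -- + i B₅.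
    have hb : b ≠ 0 := by rintro rfl; exact hbd ⟨by simpa using hb₂, by simpa using hb₃⟩
    have hb' : b' ≠ 0 := by rintro rfl; exact hbd' ⟨by simpa using hb₂', by simpa using hb₃'⟩
    obtain ⟨ξ, ξ', z, hξ, hξ', hz, hcurve, t₁, ht₁, hne⟩ := exists_curve hb hb' e c
    -- The parameters are the solution of the five linear conditions for the direction with
    -- isotropic coordinates ξ, ξ', z.
    refine ⟨fun t => ![R₁ ^ 2 / 8, 1, (ξ t + ξ' t) / 2, Complex.I * (ξ t - ξ' t) / 2, z t,
      -(p₅ + A₅ * ((ξ t + ξ' t) / 2) + B₅ * (Complex.I * (ξ t - ξ' t) / 2) + C₅ * z t),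
      (-(p₂ + a₂ * ξ t) - (p₃ + a₃ * ξ' t)) / 2,
      Complex.I * (-(p₂ + a₂ * ξ t) + (p₃ + a₃ * ξ' t)) / 2, -(p₄ + a₄ * z t)], ?_, ?_,
      t₁, ht₁, fun h => hne (congrFun h 4)⟩
    · refine DifferentiableOn.analyticOnNhd (differentiableOn_pi.2 fun i => ?_) Metric.isOpen_ball
      fin_cases i <;> simp <;> fun_prop
    · intro t ht
      obtain ⟨hS, hQ⟩ := hcurve t ht
      simp only [normalConfigurations, imageVariety, Set.mem_ofPred_eq, sphereForm, darbouxForm,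
        mannheimForm, n0, x0, xv, y0, yv, dotProduct, Fin.sum_univ_three, cons_val_zero,
        cons_val_one, cons_val, Pi.zero_apply]
      generalize ξ t = x, ξ' t = x', z t = w at *
      refine ⟨⟨⟨?_, ?_, ?_⟩, ?_, ?_, ?_, ?_, ?_⟩, trivial⟩
      · linear_combination hS + (x - x') ^ 2 / 4 * hI
      · linear_combination (a₄ ^ 2 - a₂ * a₃) * hQ + a₂ * a₃ * hS + x * hb₂ + x' * hb₂' + w * he₂
          + hc₂ + (p₂ + a₂ * x - (p₃ + a₃ * x')) ^ 2 / 4 * hI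
      · linear_combination -(a₄ - (a₂ + a₃) / 2) * hQ - (a₂ + a₃) / 2 * hS - x * hb₃ - x' * hb₃'
          - w * he₃ - hc₃ + (x - x') * (p₃ + a₃ * x' - (p₂ + a₂ * x)) / 4 * hI
      · ring
      · linear_combination
          (-a₂ * (x - x') / 2 - (p₃ + a₃ * x' - (p₂ + a₂ * x)) / 2) * hI
      · linear_combination
          (a₃ * (x - x') / 2 + (p₃ + a₃ * x' - (p₂ + a₂ * x)) / 2) * hI
      · ring
      · ring

/-- The leg parameters for which the two quadrics are proportional. -/
theorem proportional_iff {a₂ a₃ a₄ A B C R p₂ p₃ p₄ p₅ : ℂ} (h24 : a₂ - a₄ ≠ 0)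
    (h34 : a₃ - a₄ ≠ 0) :
    ((a₄ - (a₂ + a₃) / 2) * (a₂ * p₃) =
        (a₄ ^ 2 - a₂ * a₃) * (p₃ / 2 - (A + Complex.I * B) / 2) ∧
      (a₄ - (a₂ + a₃) / 2) * (a₃ * p₂) =
        (a₄ ^ 2 - a₂ * a₃) * (p₂ / 2 - (A - Complex.I * B) / 2) ∧
      (a₄ - (a₂ + a₃) / 2) * (2 * a₄ * p₄) = (a₄ ^ 2 - a₂ * a₃) * (p₄ - C) ∧
      (a₄ - (a₂ + a₃) / 2) * (p₂ * p₃ + p₄ ^ 2 + a₂ * a₃ - R ^ 2) =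
        (a₄ ^ 2 - a₂ * a₃) * ((a₂ + a₃) / 2 - p₅)) ↔
    (p₂ = -((A * (a₂ * a₃ - a₄ ^ 2) - Complex.I * (a₂ * a₃ - a₄ ^ 2) * B) / (a₃ - a₄) ^ 2) ∧
      p₃ = -((A * (a₂ * a₃ - a₄ ^ 2) + Complex.I * (a₂ * a₃ - a₄ ^ 2) * B) / (a₂ - a₄) ^ 2) ∧
      p₄ = C * (a₂ * a₃ - a₄ ^ 2) / ((a₂ - a₄) * (a₃ - a₄)) ∧
      (a₂ - a₄) ^ 2 * (a₃ - a₄) ^ 2 *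
          (2 * (a₂ * a₃ - a₄ ^ 2) * p₅ - (a₂ + a₃ - 2 * a₄) * R ^ 2
            - (2 * a₂ * a₃ - a₂ * a₄ - a₃ * a₄) * a₄)
        + (a₂ * a₃ - a₄ ^ 2) ^ 2 * (a₂ + a₃ - 2 * a₄) * (A ^ 2 + B ^ 2 + C ^ 2) = 0) := by
  have hI := Complex.I_mul_I
  have h24' := pow_ne_zero 2 h24
  have h34' := pow_ne_zero 2 h34
  rw [← neg_div, ← neg_div, eq_div_iff h34', eq_div_iff h24', eq_div_iff (mul_ne_zero h24 h34)]
  set Q := a₂ * a₃ - a₄ ^ 2 with hQ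
  -- Because (A - iB)(A + iB) = A² + B², the term p₂p₃ + p₄² turns into a multiple of the squared
  -- norm of (A, B, C), which removes p₂, p₃, p₄ from the last equation.
  have key : p₂ * (a₃ - a₄) ^ 2 = -(A * Q - Complex.I * Q * B) →
      p₃ * (a₂ - a₄) ^ 2 = -(A * Q + Complex.I * Q * B) →
      p₄ * ((a₂ - a₄) * (a₃ - a₄)) = C * Q →
      (a₂ - a₄) ^ 2 * (a₃ - a₄) ^ 2 * (p₂ * p₃ + p₄ ^ 2) = Q ^ 2 * (A ^ 2 + B ^ 2 + C ^ 2) := by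
    intro e₁ e₂ e₃
    have : p₂ * (a₃ - a₄) ^ 2 * (p₃ * (a₂ - a₄) ^ 2) + (p₄ * ((a₂ - a₄) * (a₃ - a₄))) ^ 2 =
        Q ^ 2 * (A ^ 2 + B ^ 2 + C ^ 2) := by
      rw [e₁, e₂, e₃]
      linear_combination -Q ^ 2 * B ^ 2 * hI
    rw [← this]
    ring
  constructor
  · rintro ⟨e₁, e₂, e₃, e₄⟩
    -- The coefficients of p₂ and p₃ collapse to the squares (a₃ - a₄)² and (a₂ - a₄)² up to the
    -- factor -1/2; that of p₄ is (a₂ - a₄)(a₃ - a₄).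
    have f₁ : p₂ * (a₃ - a₄) ^ 2 = -(A * Q - Complex.I * Q * B) := by
      linear_combination -2 * e₂
    have f₂ : p₃ * (a₂ - a₄) ^ 2 = -(A * Q + Complex.I * Q * B) := by
      linear_combination -2 * e₁
    have f₃ : p₄ * ((a₂ - a₄) * (a₃ - a₄)) = C * Q := by
      linear_combination e₃
    refine ⟨f₁, f₂, f₃, ?_⟩
    linear_combination -(a₂ + a₃ - 2 * a₄) * key f₁ f₂ f₃
      - 2 * (a₂ - a₄) ^ 2 * (a₃ - a₄) ^ 2 * e₄
  · rintro ⟨f₁, f₂, f₃, f₄⟩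
    refine ⟨by linear_combination -f₂ / 2, by linear_combination -f₁ / 2,
      by linear_combination f₃, mul_left_cancel₀ (mul_ne_zero h24' h34') ?_⟩
    linear_combination -(a₂ + a₃ - 2 * a₄) / 2 * key f₁ f₂ f₃ - f₄ / 2

end Pentapod

namespace Pentapod

/-! ### Change of frames -/

theorem toComplex_mulVec (O : Matrix (Fin 3) (Fin 3) ℝ) (x : Fin 3 → ℝ) :
    O.map Complex.ofReal *ᵥ (fun k => (x k : ℂ)) = fun k => ((O *ᵥ x) k : ℂ) := by
  ext k
  simp [mulVec, dotProduct]

theorem toComplex_transpose_mul {O : Matrix (Fin 3) (Fin 3) ℝ} (hO : Oᵀ * O = 1) :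
    (O.map Complex.ofReal)ᵀ * O.map Complex.ofReal = 1 := by
  rw [← Matrix.transpose_map]
  have := congrArg (fun X => X.map Complex.ofRealHom) hO
  rw [Matrix.map_mul, Matrix.map_one _ (map_zero _) (map_one _)] at this
  exact this

theorem dotProduct_mulVec_of_orthogonal {O : Matrix (Fin 3) (Fin 3) ℝ} (hO : Oᵀ * O = 1)
    (x y : Fin 3 → ℂ) :
    (O.map Complex.ofReal *ᵥ x) ⬝ᵥ (O.map Complex.ofReal *ᵥ y) = x ⬝ᵥ y := by
  rw [dotProduct_mulVec, ← mulVec_transpose, mulVec_mulVec, toComplex_transpose_mul hO, one_mulVec]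

/-- Homogeneous coordinates of a point of the line after moving the origin to `m`. -/
def movingPoint (m : ℝ) : (Fin 2 → ℂ) →ₗ[ℂ] (Fin 2 → ℂ) where
  toFun p := ![p 0, p 1 - m * p 0]
  map_add' p q := by ext i; fin_cases i <;> simp; ring
  map_smul' c p := by ext i; fin_cases i <;> simp; ring

/-- Homogeneous coordinates of a point of the base space after moving the origin to `M₀` and
rotating by `O`. -/
noncomputable def fixedPoint (M₀ : Fin 3 → ℝ) (O : Matrix (Fin 3) (Fin 3) ℝ) :
    (Fin 4 → ℂ) →ₗ[ℂ] (Fin 4 → ℂ) where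
  toFun q := Fin.cons (q 0)
    (O.map Complex.ofReal *ᵥ (Fin.tail q - q 0 • fun k => (M₀ k : ℂ)))
  map_add' p q := by
    have h : Fin.tail (p + q) - (p + q) 0 • (fun k => (M₀ k : ℂ)) =
        (Fin.tail p - p 0 • fun k => (M₀ k : ℂ)) + (Fin.tail q - q 0 • fun k => (M₀ k : ℂ)) := by
      ext k
      simp only [Fin.tail, Pi.add_apply, Pi.sub_apply, Pi.smul_apply, smul_eq_mul]
      ring
    rw [h, mulVec_add]
    ext i
    exact Fin.cases rfl (fun j => rfl) i
  map_smul' c q := by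
    have h : Fin.tail (c • q) - (c • q) 0 • (fun k => (M₀ k : ℂ)) =
        c • (Fin.tail q - q 0 • fun k => (M₀ k : ℂ)) := by
      ext k
      simp only [Fin.tail, Pi.sub_apply, Pi.smul_apply, smul_eq_mul]
      ring
    rw [h, mulVec_smul]
    ext i
    exact Fin.cases rfl (fun j => rfl) i

theorem finitePoint₃_eq (M : Fin 3 → ℂ) : finitePoint₃ M = Fin.cons 1 M := by
  ext i; fin_cases i <;> rfl

theorem idealPoint₃_eq (M : Fin 3 → ℂ) : idealPoint₃ M = Fin.cons 0 M := by
  ext i; fin_cases i <;> rfl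

theorem movingPoint_finite (m : ℝ) (a : ℂ) :
    movingPoint m (finitePoint₁ a) = finitePoint₁ (a - m) := by
  simp [movingPoint, finitePoint₁]

theorem movingPoint_ideal (m : ℝ) : movingPoint m ![0, 1] = ![0, 1] := by
  simp [movingPoint]

theorem fixedPoint_finite (M₀ : Fin 3 → ℝ) (O : Matrix (Fin 3) (Fin 3) ℝ) (M : Fin 3 → ℂ) :
    fixedPoint M₀ O (finitePoint₃ M) =
      finitePoint₃ (O.map Complex.ofReal *ᵥ (M - fun k => (M₀ k : ℂ))) := by
  simp [fixedPoint, finitePoint₃_eq]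

theorem fixedPoint_ideal (M₀ : Fin 3 → ℝ) (O : Matrix (Fin 3) (Fin 3) ℝ) (D : Fin 3 → ℂ) :
    fixedPoint M₀ O (idealPoint₃ D) = idealPoint₃ (O.map Complex.ofReal *ᵥ D) := by
  simp [fixedPoint, idealPoint₃_eq]

theorem movingPoint_injective (m : ℝ) : Function.Injective (movingPoint m) := by
  refine Function.LeftInverse.injective (g := movingPoint (-m)) fun p => ?_
  ext i
  fin_cases i <;> simp [movingPoint]

theorem fixedPoint_injective (M₀ : Fin 3 → ℝ) {O : Matrix (Fin 3) (Fin 3) ℝ} (hO : Oᵀ * O = 1) :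
    Function.Injective (fixedPoint M₀ O) := by
  rw [← LinearMap.ker_eq_bot, LinearMap.ker_eq_bot']
  intro q hq
  have h0 : q 0 = 0 := congrFun hq 0
  have h1 : O.map Complex.ofReal *ᵥ (Fin.tail q - q 0 • fun k => (M₀ k : ℂ)) = 0 := by
    ext k
    exact congrFun hq k.succ
  have h2 := congrArg (mulVec (O.map Complex.ofReal)ᵀ) h1
  rw [mulVec_mulVec, toComplex_transpose_mul hO, one_mulVec, mulVec_zero, h0, zero_smul,
    sub_zero] at h2
  ext i
  exact Fin.cases h0 (fun j => congrFun h2 j) i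

/-- Motion parameters after a change of frames. -/
noncomputable def changeMotion (m : ℝ) (M₀ : Fin 3 → ℝ) (O : Matrix (Fin 3) (Fin 3) ℝ)
    (v : Fin 9 → ℂ) : Fin 9 → ℂ :=
  let M := fun k => (M₀ k : ℂ)
  let x := O.map Complex.ofReal *ᵥ xv v
  -- With a' = a - m one has O(-a x - y - M₀) = -a' (O x) - O(y + x₀ M₀ + m x) for x₀ = 1. The
  -- entries for n₀ and y₀ are then dictated by Φ₂ and Φ₃.
  let y := O.map Complex.ofReal *ᵥ (yv v + x0 v • M + (m : ℂ) • xv v)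
  ![n0 v + (x0 v * (M ⬝ᵥ M + m ^ 2) + 2 * (M ⬝ᵥ yv v) + 2 * m * y0 v + 2 * m * (M ⬝ᵥ xv v)) / 8,
    x0 v, x 0, x 1, x 2, y0 v + M ⬝ᵥ xv v + m * x0 v, y 0, y 1, y 2]

section changeMotion

variable (m : ℝ) (M₀ : Fin 3 → ℝ) (O : Matrix (Fin 3) (Fin 3) ℝ) (v : Fin 9 → ℂ)

theorem xv_changeMotion : xv (changeMotion m M₀ O v) = O.map Complex.ofReal *ᵥ xv v := by
  ext i; fin_cases i <;> rfl

theorem yv_changeMotion : yv (changeMotion m M₀ O v) =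
    O.map Complex.ofReal *ᵥ (yv v + x0 v • (fun k => (M₀ k : ℂ)) + (m : ℂ) • xv v) := by
  ext i; fin_cases i <;> rfl

theorem x0_changeMotion : x0 (changeMotion m M₀ O v) = x0 v := rfl

theorem y0_changeMotion : y0 (changeMotion m M₀ O v) =
    y0 v + (fun k => (M₀ k : ℂ)) ⬝ᵥ xv v + m * x0 v := rfl

theorem n0_changeMotion : n0 (changeMotion m M₀ O v) =
    n0 v + (x0 v * ((fun k => (M₀ k : ℂ)) ⬝ᵥ (fun k => (M₀ k : ℂ)) + m ^ 2)
      + 2 * ((fun k => (M₀ k : ℂ)) ⬝ᵥ yv v) + 2 * m * y0 v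
      + 2 * m * ((fun k => (M₀ k : ℂ)) ⬝ᵥ xv v)) / 8 := rfl

variable {O v}

theorem changeMotion_mem_imageVariety (hO : Oᵀ * O = 1) (hv : v ∈ imageVariety) :
    changeMotion m M₀ O v ∈ imageVariety := by
  obtain ⟨h1, h2, h3⟩ := hv
  refine ⟨?_, ?_, ?_⟩
  · rw [xv_changeMotion, dotProduct_mulVec_of_orthogonal hO, x0_changeMotion, h1]
  · rw [yv_changeMotion, dotProduct_mulVec_of_orthogonal hO, x0_changeMotion, n0_changeMotion]
    simp only [add_dotProduct, dotProduct_add, smul_dotProduct, dotProduct_smul, smul_eq_mul]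
    rw [dotProduct_comm (yv v) (xv v), dotProduct_comm (yv v) (fun k => (M₀ k : ℂ)),
      dotProduct_comm (xv v) (fun k => (M₀ k : ℂ))]
    linear_combination h2 + 2 * m * h3 + m ^ 2 * h1
  · rw [xv_changeMotion, yv_changeMotion, dotProduct_mulVec_of_orthogonal hO, x0_changeMotion,
      y0_changeMotion]
    simp only [dotProduct_add, dotProduct_smul, smul_eq_mul]
    rw [dotProduct_comm (xv v) (fun k => (M₀ k : ℂ))]
    linear_combination h3 + m * h1

/-- On poses the form is half of squared distance minus ρ, hence frame independent. The equality
holds between linear forms in v, so membership in the image variety is not needed. -/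
theorem sphereForm_changeMotion (hO : Oᵀ * O = 1) (a : ℂ) (M : Fin 3 → ℂ) (ρ : ℂ) :
    sphereForm (a - m) (O.map Complex.ofReal *ᵥ (M - fun k => (M₀ k : ℂ))) ρ
      (changeMotion m M₀ O v) = sphereForm a M ρ v := by
  simp only [sphereForm, xv_changeMotion, yv_changeMotion, x0_changeMotion, y0_changeMotion,
    n0_changeMotion, dotProduct_mulVec_of_orthogonal hO]
  simp only [dotProduct_add, dotProduct_smul, smul_eq_mul, sub_dotProduct, dotProduct_sub]
  rw [dotProduct_comm M (fun k => (M₀ k : ℂ))]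
  ring

end changeMotion

end Pentapod

namespace LinearPentapod

open Pentapod

variable {P : LinearPentapod} {m : ℝ} {M₀ : Fin 3 → ℝ} {O : Matrix (Fin 3) (Fin 3) ℝ}

theorem Mc_changeFrames (i : Fin 5) : (P.changeFrames m M₀ O).Mc i =
    O.map Complex.ofReal *ᵥ (P.Mc i - fun k => (M₀ k : ℂ)) := by
  have : P.Mc i - (fun k => (M₀ k : ℂ)) = fun k => (((P.M i - M₀) k : ℝ) : ℂ) := by
    ext k; simp [Mc]
  rw [this, toComplex_mulVec]
  rfl

theorem changeFrames_changeFrames (hO : Oᵀ * O = 1) :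
    (P.changeFrames m M₀ O).changeFrames (-m) (-(O *ᵥ M₀)) Oᵀ = P := by
  obtain ⟨a, M⟩ := P
  simp only [changeFrames, LinearPentapod.mk.injEq]
  refine ⟨by ext i; ring, funext fun i => ?_⟩
  rw [sub_neg_eq_add, ← mulVec_add, sub_add_cancel, mulVec_mulVec, hO, one_mulVec]

theorem HasSelfMotion.changeFrames (hO : Oᵀ * O = 1) {ρ : Fin 5 → ℂ}
    (h : HasSelfMotion (P.configurations ρ)) :
    HasSelfMotion ((P.changeFrames m M₀ O).configurations ρ) := by
  obtain ⟨γ, hγ, hC, t₁, ht₁, hne⟩ := h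
  refine ⟨fun t => changeMotion m M₀ O (γ t), ?_, fun t ht => ⟨⟨?_, fun i => ?_⟩, (hC t ht).2⟩,
    t₁, ht₁, fun heq => hne ?_⟩
  · refine DifferentiableOn.analyticOnNhd (differentiableOn_pi.2 fun i => ?_) Metric.isOpen_ball
    have hd : ∀ j, DifferentiableOn ℂ (fun t => γ t j) (Metric.ball 0 1) :=
      differentiableOn_pi.1 hγ.differentiableOn
    have d0 := hd 0
    have d1 := hd 1
    have d2 := hd 2
    have d3 := hd 3
    have d4 := hd 4
    have d5 := hd 5
    have d6 := hd 6
    have d7 := hd 7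
    have d8 := hd 8
    fin_cases i <;>
      simp [changeMotion, n0, x0, xv, y0, yv, mulVec, dotProduct, Fin.sum_univ_three,
        vecHead, vecTail] <;> fun_prop
  · exact changeMotion_mem_imageVariety m M₀ hO (hC t ht).1.1
  · rw [Mc_changeFrames]
    have := sphereForm_changeMotion m M₀ hO (v := γ t) (P.a i) (P.Mc i) (ρ i)
    rw [(hC t ht).1.2 i] at this
    rw [← this]
    simp [LinearPentapod.changeFrames]
  -- The change of motion parameters can be undone in the order x, y, y₀, n₀, which preserves
  -- nonconstancy.
  · have hinj : Function.Injective (mulVec (O.map Complex.ofReal)) := fun x y hxy => by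
      have := congrArg (mulVec (O.map Complex.ofReal)ᵀ) hxy
      simpa [mulVec_mulVec, toComplex_transpose_mul hO] using this
    have h1 : x0 (γ t₁) = x0 (γ 0) := by rw [(hC t₁ ht₁).2, (hC 0 (by simp)).2]
    have hx : xv (γ t₁) = xv (γ 0) := hinj (by
      rw [← xv_changeMotion m M₀, ← xv_changeMotion m M₀]; exact congrArg xv heq)
    have hy : yv (γ t₁) = yv (γ 0) := by
      have := congrArg yv heq
      simp only [yv_changeMotion] at this
      replace this := hinj this
      rw [h1, hx] at this
      simpa using this
    have hy0 : y0 (γ t₁) = y0 (γ 0) := by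
      have := congrArg y0 heq
      simp only [y0_changeMotion, h1, hx] at this
      simpa using this
    have hn : n0 (γ t₁) = n0 (γ 0) := by
      have := congrArg n0 heq
      simp only [n0_changeMotion, h1, hx, hy, hy0] at this
      simpa using this
    ext i
    fin_cases i
    exacts [hn, h1, congrFun hx 0, congrFun hx 1, congrFun hx 2, hy0, congrFun hy 0, congrFun hy 1,
      congrFun hy 2]

theorem hasSelfMotion_changeFrames_iff (hO : Oᵀ * O = 1) {ρ : Fin 5 → ℂ} :
    HasSelfMotion ((P.changeFrames m M₀ O).configurations ρ) ↔
      HasSelfMotion (P.configurations ρ) := by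
  refine ⟨fun h => ?_, HasSelfMotion.changeFrames hO⟩
  have := HasSelfMotion.changeFrames (m := -m) (M₀ := -(O *ᵥ M₀)) (O := Oᵀ)
    (by rw [transpose_transpose]; exact mul_eq_one_comm.1 hO) h
  rwa [changeFrames_changeFrames hO] at this

/-- Frame changes act linearly on both factors of u ⊗ q and map anchor pairs to anchor pairs, so the
same coefficients c serve in the new frames. -/
theorem Corresponds.changeFrames {p : Fin 2 → ℂ} {q : Fin 4 → ℂ} (h : P.Corresponds p q) :
    (P.changeFrames m M₀ O).Corresponds (movingPoint m p) (fixedPoint M₀ O q) := by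
  have hvec : ∀ p q, vecMulVec (movingPoint m p) (fixedPoint M₀ O q) =
      LinearMap.toMatrix' (movingPoint m) * vecMulVec p q *
        (LinearMap.toMatrix' (fixedPoint M₀ O))ᵀ := fun p q => by
    rw [mul_vecMulVec, vecMulVec_mul, vecMul_transpose, LinearMap.toMatrix'_mulVec,
      LinearMap.toMatrix'_mulVec]
  unfold Corresponds at h ⊢
  rw [Submodule.mem_span_range_iff_exists_fun] at h ⊢
  obtain ⟨c, hc⟩ := h
  refine ⟨c, ?_⟩
  rw [hvec, ← hc, Matrix.mul_sum, Matrix.sum_mul]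
  refine Finset.sum_congr rfl fun i _ => ?_
  rw [Matrix.mul_smul, Matrix.smul_mul, ← hvec, movingPoint_finite, fixedPoint_finite, Mc_changeFrames]
  simp [LinearPentapod.changeFrames]

/-- Every point of the line corresponds to at most one point of the base space. -/
def CorrespondsSingleValued (P : LinearPentapod) : Prop :=
  ∀ (p : Fin 2 → ℂ) (q q' : Fin 4 → ℂ), p ≠ 0 → q ≠ 0 → q' ≠ 0 →
    P.Corresponds p q → P.Corresponds p q' → ∃ c : ℂ, q' = c • q

theorem CorrespondsSingleValued.changeFrames (hP : P.CorrespondsSingleValued) (hO : Oᵀ * O = 1) :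
    (P.changeFrames m M₀ O).CorrespondsSingleValued := by
  intro p q q' hp hq hq' h h'
  have hO' : Oᵀᵀ * Oᵀ = 1 := by rw [transpose_transpose]; exact mul_eq_one_comm.1 hO
  have hinj := fixedPoint_injective (-(O *ᵥ M₀)) hO'
  have h₁ := Corresponds.changeFrames (m := -m) (M₀ := -(O *ᵥ M₀)) (O := Oᵀ) h
  have h₂ := Corresponds.changeFrames (m := -m) (M₀ := -(O *ᵥ M₀)) (O := Oᵀ) h'
  rw [changeFrames_changeFrames hO] at h₁ h₂
  obtain ⟨c, hc⟩ := hP _ _ _ ((map_ne_zero_iff _ (movingPoint_injective _)).2 hp)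
    ((map_ne_zero_iff _ hinj).2 hq) ((map_ne_zero_iff _ hinj).2 hq') h₁ h₂
  exact ⟨c, hinj (by rw [hc, map_smul])⟩

theorem Corresponds.smul_left {p : Fin 2 → ℂ} {q : Fin 4 → ℂ} (h : P.Corresponds p q) (c : ℂ) :
    P.Corresponds (c • p) q := by
  unfold Corresponds at h ⊢
  rw [smul_vecMulVec]
  exact Submodule.smul_mem _ c h

theorem corresponds_anchor (P : LinearPentapod) (i : Fin 5) :
    P.Corresponds (finitePoint₁ (P.a i)) (finitePoint₃ (P.Mc i)) :=
  Submodule.subset_span ⟨i, rfl⟩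

end LinearPentapod

/-! ### Adapted rotations and points of the twisted cubic. -/

namespace Pentapod

/-- The rows of the matrix are e, (d × e)/|d| and d/|d| for a unit vector e orthogonal to d; in this
order the determinant is +1. -/
theorem exists_rotation {d : Fin 3 → ℝ} (hd : d ≠ 0) :
    ∃ O ∈ Matrix.specialOrthogonalGroup (Fin 3) ℝ, ∃ r : ℝ, r ≠ 0 ∧ O *ᵥ d = ![0, 0, r] := by
  obtain ⟨e, he, hed⟩ : ∃ e : Fin 3 → ℝ, e ⬝ᵥ e = 1 ∧ e ⬝ᵥ d = 0 := by
    by_cases h : d 0 ^ 2 + d 1 ^ 2 = 0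
    · have h0 : d 0 = 0 := by nlinarith [sq_nonneg (d 0), sq_nonneg (d 1)]
      exact ⟨![1, 0, 0], by simp, by simp [dotProduct, Fin.sum_univ_three, h0]⟩
    · have hp : 0 < d 0 ^ 2 + d 1 ^ 2 := lt_of_le_of_ne (by positivity) (Ne.symm h)
      set s := Real.sqrt (d 0 ^ 2 + d 1 ^ 2)
      have hs : s ^ 2 = d 0 ^ 2 + d 1 ^ 2 := Real.sq_sqrt hp.le
      have hs0 : s ≠ 0 := (Real.sqrt_pos.2 hp).ne'
      refine ⟨![d 1 / s, -d 0 / s, 0], ?_, ?_⟩ <;> simp [dotProduct, Fin.sum_univ_three]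
      · field_simp
        linarith
      · field_simp
        ring
  have hdp : 0 < d ⬝ᵥ d :=
    lt_of_le_of_ne (Finset.sum_nonneg fun i _ => mul_self_nonneg (d i)) (Ne.symm fun h => hd (dotProduct_self_eq_zero.1 h))
  set r := Real.sqrt (d ⬝ᵥ d)
  have hr : r ^ 2 = d ⬝ᵥ d := Real.sq_sqrt hdp.le
  have hr0 : r ≠ 0 := (Real.sqrt_pos.2 hdp).ne'
  simp only [dotProduct, Fin.sum_univ_three] at he hed hr
  have hrow : (Matrix.of ![e, ![(d 1 * e 2 - d 2 * e 1) / r, (d 2 * e 0 - d 0 * e 2) / r,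
      (d 0 * e 1 - d 1 * e 0) / r], ![d 0 / r, d 1 / r, d 2 / r]]) *
      (Matrix.of ![e, ![(d 1 * e 2 - d 2 * e 1) / r, (d 2 * e 0 - d 0 * e 2) / r,
      (d 0 * e 1 - d 1 * e 0) / r], ![d 0 / r, d 1 / r, d 2 / r]])ᵀ = 1 := by
    ext i j
    fin_cases i <;> fin_cases j <;> simp [Matrix.mul_apply, Fin.sum_univ_three] <;> field_simp
    · linear_combination he
    · ring
    · linear_combination hed
    · ring
    · linear_combination (d 0 * d 0 + d 1 * d 1 + d 2 * d 2) * he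
        - (e 0 * d 0 + e 1 * d 1 + e 2 * d 2) * hed - hr
    · ring
    · linear_combination hed
    · ring
    · linear_combination -hr
  refine ⟨_, Matrix.mem_specialOrthogonalGroup_iff.2
    ⟨(Matrix.mem_orthogonalGroup_iff (Fin 3) ℝ).2 hrow, ?_⟩, r, hr0, ?_⟩
  · rw [Matrix.det_fin_three]
    simp
    field_simp
    linear_combination (d 0 * d 0 + d 1 * d 1 + d 2 * d 2) * he
        - (e 0 * d 0 + e 1 * d 1 + e 2 * d 2) * hed - hr
  · ext i
    fin_cases i <;> simp [mulVec, dotProduct, Fin.sum_univ_three] <;> field_simp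
    · linear_combination hed
    · ring
    · linear_combination -hr

theorem finitePoint₁_ne_zero (a : ℂ) : finitePoint₁ a ≠ 0 := fun h => by
  simpa [finitePoint₁] using congrFun h 0

theorem finitePoint₃_ne_zero (M : Fin 3 → ℂ) : finitePoint₃ M ≠ 0 := fun h => by
  simpa [finitePoint₃] using congrFun h 0

theorem idealPoint₃_ne_zero {D : Fin 3 → ℂ} (hD : D ≠ 0) : idealPoint₃ D ≠ 0 := fun h => hD <| by
  rw [idealPoint₃_eq] at h
  ext k
  exact congrFun h k.succ

theorem cubicPoint_eq (G : Matrix (Fin 4) (Fin 4) ℝ) (p : Fin 2 → ℂ) :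
    cubicPoint G p = G.map Complex.ofReal *ᵥ fun k => p 0 ^ (3 - (k : ℕ)) * p 1 ^ (k : ℕ) := by
  ext j
  simp [cubicPoint, mulVec, dotProduct, mul_assoc]

theorem cubicPoint_conj (G : Matrix (Fin 4) (Fin 4) ℝ) (p : Fin 2 → ℂ) :
    cubicPoint G (fun i => starRingEnd ℂ (p i)) = fun j => starRingEnd ℂ (cubicPoint G p j) := by
  ext j
  simp [cubicPoint]

/-- Proportional points of a twisted cubic have equal parameters. -/
theorem cubicPoint_finite_injective {G : Matrix (Fin 4) (Fin 4) ℝ} (hG : G.det ≠ 0) {a b c c' : ℂ}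
    (h : c • cubicPoint G (finitePoint₁ a) = c' • cubicPoint G (finitePoint₁ b))
    (h0 : c • cubicPoint G (finitePoint₁ a) ≠ 0) : a = b := by
  have hdet : IsUnit (G.map Complex.ofReal) := by
    rw [Matrix.isUnit_iff_isUnit_det, isUnit_iff_ne_zero]
    have : (G.map Complex.ofReal).det = (G.det : ℂ) := (Complex.ofRealHom.map_det G).symm
    rw [this]
    exact_mod_cast hG
  have hc : c ≠ 0 := by rintro rfl; simp at h0
  rw [cubicPoint_eq, cubicPoint_eq, ← mulVec_smul, ← mulVec_smul] at h
  have h' := Matrix.mulVec_injective_of_isUnit hdet h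
  -- After cancelling the invertible G, the vectors (1, a, a², a³) and (1, b, b², b³) are
  -- proportional; their first two entries suffice.
  have e0 := congrFun h' 0
  have e1 := congrFun h' 1
  simp [finitePoint₁] at e0 e1
  rw [← e0] at e1
  exact mul_left_cancel₀ hc e1

end Pentapod

/-! ### Consequences of Type 1 and existence of the coordinatization. -/

namespace LinearPentapod

open Pentapod

variable {P : LinearPentapod}

theorem IsTypeOne.singleValued (hP : P.IsTypeOne) : P.CorrespondsSingleValued := by
  obtain ⟨G, -, hG⟩ := hP.cubic
  intro p q q' hp hq hq' h h'
  obtain ⟨c, hc⟩ := (hG p q hp hq).1 h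
  obtain ⟨c', hc'⟩ := (hG p q' hp hq').1 h'
  have h0 : c ≠ 0 := by rintro rfl; simp [hc] at hq
  exact ⟨c' / c, by rw [hc, hc', smul_smul, div_mul_cancel₀ _ h0]⟩

/-- The cubic forms are real, so complex conjugation commutes with the parametrization. -/
theorem IsTypeOne.corresponds_conj (hP : P.IsTypeOne) {p : Fin 2 → ℂ} {q : Fin 4 → ℂ}
    (hp : p ≠ 0) (hq : q ≠ 0) (h : P.Corresponds p q) :
    P.Corresponds (fun i => starRingEnd ℂ (p i)) (fun i => starRingEnd ℂ (q i)) := by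
  obtain ⟨G, -, hG⟩ := hP.cubic
  have hne : ∀ {n : ℕ} {v : Fin n → ℂ}, v ≠ 0 → (fun i => starRingEnd ℂ (v i)) ≠ 0 := by
    intro n v hv h
    apply hv
    ext i
    simpa using congrFun h i
  obtain ⟨c, rfl⟩ := (hG p q hp hq).1 h
  refine (hG _ _ (hne hp) (hne hq)).2 ⟨starRingEnd ℂ c, ?_⟩
  ext i
  simp [cubicPoint_conj]

theorem IsTypeOne.finite_unique (hP : P.IsTypeOne) {a b : ℂ} {q : Fin 4 → ℂ} (hq : q ≠ 0)
    (h : P.Corresponds (finitePoint₁ a) q) (h' : P.Corresponds (finitePoint₁ b) q) : a = b := by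
  obtain ⟨G, hdet, hG⟩ := hP.cubic
  obtain ⟨c, hc⟩ := (hG _ q (finitePoint₁_ne_zero a) hq).1 h
  obtain ⟨c', hc'⟩ := (hG _ q (finitePoint₁_ne_zero b) hq).1 h'
  exact cubicPoint_finite_injective hdet (hc ▸ hc') (hc ▸ hq)

/-- If the ideal point of the line corresponds to no finite point, then the affine relation
holds. -/
theorem affineRelation_of_ideal
    (h : ∀ q : Fin 4 → ℂ, P.Corresponds ![0, 1] q → q 0 = 0) : P.AffineRelation := by
  let T : (Fin 5 → ℝ) →ₗ[ℝ] (ℝ × (Fin 3 → ℝ)) := Fintype.linearCombination ℝ fun i => (1, P.M i)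
  let φ : (Fin 5 → ℝ) →ₗ[ℝ] ℝ := Fintype.linearCombination ℝ P.a
  have hφ : φ ∈ T.ker.dualAnnihilator := by
    rw [Submodule.mem_dualAnnihilator]
    intro c hc
    rw [LinearMap.mem_ker, Fintype.linearCombination_apply, Prod.ext_iff, Prod.fst_sum,
      Prod.snd_sum] at hc
    obtain ⟨h1, h2⟩ := hc
    simp only [Prod.smul_mk, smul_eq_mul, mul_one, Prod.fst_zero, Prod.snd_zero] at h1 h2
    have h1c : ∑ i, (c i : ℂ) = 0 := by exact_mod_cast h1
    have h2c : ∀ k, ∑ i, (c i : ℂ) * P.M i k = 0 := fun k => by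
      have := congrFun h2 k
      simp only [Finset.sum_apply, Pi.smul_apply, smul_eq_mul, Pi.zero_apply] at this
      exact_mod_cast this
    -- For an affine dependency c of the base points, ∑ cᵢ (1, aᵢ) ⊗ (1, Mᵢ) = (0, 1) ⊗ ∑ cᵢ aᵢ (1,
    -- Mᵢ). The hypothesis then reads ∑ cᵢ aᵢ = 0, so c is also a dependency of the platform
    -- coordinates and these factor through an affine map.
    have := h (∑ i, ((c i * P.a i : ℝ) : ℂ) • finitePoint₃ (P.Mc i)) (by
      unfold Corresponds
      rw [Submodule.mem_span_range_iff_exists_fun]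
      refine ⟨fun i => (c i : ℂ), ?_⟩
      ext i j
      rw [Matrix.sum_apply]
      fin_cases i
      · fin_cases j <;> simp [vecMulVec_apply, finitePoint₁, finitePoint₃, Mc, h1c, h2c]
      · simp [vecMulVec_apply, finitePoint₁, mul_assoc, Matrix.smul_apply, -vecMulVec_cons,
          -cons_vecMulVec])
    simp [finitePoint₃] at this
    rw [Fintype.linearCombination_apply]
    simp only [smul_eq_mul]
    exact_mod_cast this
  rw [← LinearMap.range_dualMap_eq_dualAnnihilator_ker] at hφ
  obtain ⟨κ, hκ⟩ := hφ
  refine ⟨(κ.comp (LinearMap.inr ℝ ℝ (Fin 3 → ℝ))).toAffineMap + AffineMap.const ℝ _ (κ (1, 0)),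
    fun i => ?_⟩
  have := LinearMap.congr_fun hκ (Pi.single i 1)
  rw [LinearMap.dualMap_apply] at this
  simp [T, φ] at this
  rw [← this]
  simp [← map_add]

/-- The image of (0 : 1) is the last column of G, which is real; its first entry is nonzero, as
otherwise the affine relation would hold. -/
theorem IsTypeOne.exists_finite_of_ideal (hP : P.IsTypeOne) :
    ∃ M : Fin 3 → ℝ, P.Corresponds ![0, 1] (finitePoint₃ fun k => (M k : ℂ)) := by
  obtain ⟨G, hdet, hG⟩ := hP.cubic
  have hp : (![0, 1] : Fin 2 → ℂ) ≠ 0 := fun h => by simpa using congrFun h 1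
  have hcub : cubicPoint G ![0, 1] = fun j => (G j 3 : ℂ) := by
    ext j
    simp [cubicPoint, Fin.sum_univ_four]
  have h03 : G 0 3 ≠ 0 := fun h0 => hP.not_affine <| affineRelation_of_ideal fun q hq => by
    by_cases hq0 : q = 0
    · simp [hq0]
    · obtain ⟨c, hc⟩ := (hG _ q hp hq0).1 hq
      rw [hc, hcub]
      simp [h0]
  have h03' : (G 0 3 : ℂ) ≠ 0 := by exact_mod_cast h03
  refine ⟨fun k => G k.succ 3 / G 0 3, (hG _ _ hp (finitePoint₃_ne_zero _)).2
    ⟨(G 0 3 : ℂ)⁻¹, ?_⟩⟩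
  rw [hcub]
  ext j
  fin_cases j <;> simp [finitePoint₃, h03', div_eq_inv_mul]

theorem IsTypeOne.exists_finite_to_ideal (hP : P.IsTypeOne) {p : Fin 2 → ℂ} (hp : p ≠ 0)
    {D : Fin 3 → ℂ} (hD : D ≠ 0) (h : P.Corresponds p (idealPoint₃ D)) :
    ∃ a, P.Corresponds (finitePoint₁ a) (idealPoint₃ D) := by
  have h0 : p 0 ≠ 0 := by
    intro h0
    have h1 : p 1 ≠ 0 := fun h1 => hp (by ext i; fin_cases i; exacts [h0, h1])
    obtain ⟨M, hM⟩ := hP.exists_finite_of_ideal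
    have hp' : (p 1)⁻¹ • p = ![0, 1] := by
      ext i
      fin_cases i <;> simp [h0, h1]
    have h' := h.smul_left (p 1)⁻¹
    rw [hp'] at h'
    obtain ⟨c, hc⟩ := hP.singleValued _ _ _ (fun h => by simpa using congrFun h 1)
      (idealPoint₃_ne_zero hD) (finitePoint₃_ne_zero _) h' hM
    simpa [finitePoint₃, idealPoint₃] using congrFun hc 0
  refine ⟨p 1 / p 0, ?_⟩
  convert h.smul_left (p 0)⁻¹ using 1
  ext i
  fin_cases i <;> simp [finitePoint₁, h0, div_eq_inv_mul]

/-- Every real finite pair of corresponding points can serve as pair of origins. -/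
theorem exists_coordinatized (hP : P.IsTypeOne) (hD : P.Duporcq) {m : ℝ} {M₁ : Fin 3 → ℝ}
    (h₁ : P.Corresponds (finitePoint₁ m) (finitePoint₃ fun k => (M₁ k : ℂ))) :
    ∃ O ∈ Matrix.specialOrthogonalGroup (Fin 3) ℝ, ∃ (a₂ a₃ : ℂ) (a₄ A₅ B₅ C₅ : ℝ),
      (P.changeFrames m M₁ O).Coordinatized a₂ a₃ a₄ A₅ B₅ C₅ := by
  obtain ⟨d, hd, hDd⟩ := hD
  obtain ⟨O, hO, r, hr, hOd⟩ := exists_rotation hd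
  have hOO : O * Oᵀ = 1 :=
    (Matrix.mem_orthogonalGroup_iff (Fin 3) ℝ).1 (Matrix.mem_specialOrthogonalGroup_iff.1 hO).1
  have hOO' : Oᵀ * O = 1 := mul_eq_one_comm.1 hOO
  have hOT : Oᵀᵀ * Oᵀ = 1 := by rwa [transpose_transpose]
  -- transport of ideal points to the rotated frame
  have hback : ∀ w : Fin 3 → ℂ, O.map Complex.ofReal *ᵥ (Oᵀ.map Complex.ofReal *ᵥ w) = w := by
    intro w
    have := toComplex_transpose_mul hOT
    rw [← Matrix.transpose_map, transpose_transpose] at this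
    rw [mulVec_mulVec, this, one_mulVec]
  have hdO : (fun k => (d k : ℂ)) = Oᵀ.map Complex.ofReal *ᵥ ![0, 0, (r : ℂ)] := by
    have : d = Oᵀ *ᵥ ![0, 0, r] := by rw [← hOd, mulVec_mulVec, hOO', one_mulVec]
    have h3 : (![0, 0, (r : ℂ)] : Fin 3 → ℂ) = fun k => ((![0, 0, r] : Fin 3 → ℝ) k : ℂ) := by
      ext k; fin_cases k <;> simp
    rw [h3, toComplex_mulVec, ← this]
  have hcorr : ∀ {a : ℂ} {w : Fin 3 → ℂ},
      P.Corresponds (finitePoint₁ a) (idealPoint₃ (Oᵀ.map Complex.ofReal *ᵥ w)) →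
      (P.changeFrames m M₁ O).Corresponds (finitePoint₁ (a - m)) (idealPoint₃ w) := by
    intro a w h
    have := h.changeFrames (m := m) (M₀ := M₁) (O := O)
    rwa [movingPoint_finite, fixedPoint_ideal, hback] at this
  have hne : ∀ {w : Fin 3 → ℂ}, w ≠ 0 → Oᵀ.map Complex.ofReal *ᵥ w ≠ 0 := fun hw h => hw <| by
    have := hback _ ▸ congrArg (mulVec (O.map Complex.ofReal)) h
    simpa using this
  have hconj : ∀ w : Fin 3 → ℂ,
      (fun i => starRingEnd ℂ (idealPoint₃ (Oᵀ.map Complex.ofReal *ᵥ w) i)) =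
        idealPoint₃ (Oᵀ.map Complex.ofReal *ᵥ fun k => starRingEnd ℂ (w k)) := by
    intro w
    ext i
    fin_cases i <;> simp [idealPoint₃, mulVec, dotProduct]
  have hconj₁ : ∀ a : ℂ,
      (fun i => starRingEnd ℂ (finitePoint₁ a i)) = finitePoint₁ (starRingEnd ℂ a) := by
    intro a
    ext i
    fin_cases i <;> simp [finitePoint₁]
  have hw₂ : (![1, -Complex.I, 0] : Fin 3 → ℂ) ≠ 0 := fun h => by simpa using congrFun h 0
  have hw₄ : (![0, 0, 1] : Fin 3 → ℂ) ≠ 0 := fun h => by simpa using congrFun h 2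
  -- In the rotated frame d points along the third axis, so (1, -i, 0) is a cyclic point of the
  -- planes orthogonal to d and must lie on the cubic.
  obtain ⟨p₂, hp₂, hc₂⟩ := (hDd _ (hne hw₂)).2 (Or.inr (by
    rw [hdO, dotProduct_mulVec_of_orthogonal hOT, dotProduct_mulVec_of_orthogonal hOT]
    simp [dotProduct, Fin.sum_univ_three]))
  obtain ⟨p₄, hp₄, hc₄⟩ := (hDd _ (hne hw₄)).2 (Or.inl ⟨(r : ℂ)⁻¹, by
    have hr' : (r : ℂ) ≠ 0 := by exact_mod_cast hr
    rw [hdO, ← mulVec_smul]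
    simp [hr']⟩)
  obtain ⟨b₂, hb₂⟩ := hP.exists_finite_to_ideal hp₂ (hne hw₂) hc₂
  obtain ⟨b₄, hb₄⟩ := hP.exists_finite_to_ideal hp₄ (hne hw₄) hc₄
  have hb₃ := hP.corresponds_conj (finitePoint₁_ne_zero _) (idealPoint₃_ne_zero (hne hw₂)) hb₂
  have hb₄' := hP.corresponds_conj (finitePoint₁_ne_zero _) (idealPoint₃_ne_zero (hne hw₄)) hb₄
  rw [hconj, hconj₁] at hb₃ hb₄'
  have e₃ : (fun k => starRingEnd ℂ ((![1, -Complex.I, 0] : Fin 3 → ℂ) k)) =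
      ![1, Complex.I, 0] := by
    ext k; fin_cases k <;> simp
  have e₄ : (fun k => starRingEnd ℂ ((![0, 0, 1] : Fin 3 → ℂ) k)) = ![0, 0, 1] := by
    ext k; fin_cases k <;> simp
  rw [e₃] at hb₃
  rw [e₄] at hb₄'
  -- The direction (0, 0, 1) is real and has only one finite preimage, which is therefore fixed by
  -- conjugation.
  obtain ⟨a₄, rfl⟩ := Complex.conj_eq_iff_real.1
    (hP.finite_unique (idealPoint₃_ne_zero (hne hw₄)) hb₄' hb₄)
  obtain ⟨M, hM⟩ := hP.exists_finite_of_ideal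
  refine ⟨O, hO, b₂ - m, starRingEnd ℂ b₂ - m, a₄ - m, (O *ᵥ (M - M₁)) 0, (O *ᵥ (M - M₁)) 1,
    (O *ᵥ (M - M₁)) 2, by simp, ?_, hcorr hb₂, hcorr hb₃, ?_, ?_⟩
  · have := h₁.changeFrames (m := m) (M₀ := M₁) (O := O)
    rwa [movingPoint_finite, fixedPoint_finite, sub_self, sub_self, mulVec_zero] at this
  · have := hcorr hb₄
    push_cast
    exact this
  · have := hM.changeFrames (m := m) (M₀ := M₁) (O := O)
    rw [movingPoint_ideal, fixedPoint_finite] at this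
    have e : ((fun k => (M k : ℂ)) - fun k => (M₁ k : ℂ)) = fun k => ((M - M₁) k : ℂ) := by
      ext k; simp
    rw [e, toComplex_mulVec] at this
    convert this using 2
    ext k; fin_cases k <;> rfl

end LinearPentapod

/-! ### Linear algebra of replacing the five legs. -/

namespace Pentapod

/-- The pairing of the coefficients `p i * q j` of a leg condition with the motion parameters. -/
def pairing (X : Matrix (Fin 2) (Fin 4) ℂ) (v : Fin 9 → ℂ) : ℂ :=
  X 0 0 * (4 * n0 v) + X 0 1 * yv v 0 + X 0 2 * yv v 1 + X 0 3 * yv v 2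
    + X 1 0 * y0 v + X 1 1 * xv v 0 + X 1 2 * xv v 1 + X 1 3 * xv v 2

theorem sphereForm_eq_pairing (a : ℂ) (M : Fin 3 → ℂ) (ρ : ℂ) (v : Fin 9 → ℂ) :
    sphereForm a M ρ v = 1 / 2 * (a ^ 2 + M ⬝ᵥ M - ρ) * x0 v
      + pairing (vecMulVec (finitePoint₁ a) (finitePoint₃ M)) v := by
  simp only [sphereForm, pairing, vecMulVec_apply, finitePoint₁, finitePoint₃, dotProduct,
    Fin.sum_univ_three, cons_val_zero, cons_val_one, cons_val]
  ring

theorem darbouxForm_eq_pairing (a : ℂ) (D : Fin 3 → ℂ) (p : ℂ) (v : Fin 9 → ℂ) :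
    darbouxForm a D p v = p * x0 v
      + pairing (vecMulVec (finitePoint₁ a) (idealPoint₃ D)) v := by
  simp only [darbouxForm, pairing, vecMulVec_apply, finitePoint₁, idealPoint₃, dotProduct,
    Fin.sum_univ_three, cons_val_zero, cons_val_one, cons_val]
  ring

theorem mannheimForm_eq_pairing (M : Fin 3 → ℂ) (p : ℂ) (v : Fin 9 → ℂ) :
    mannheimForm M p v = p * x0 v + pairing (vecMulVec ![0, 1] (finitePoint₃ M)) v := by
  simp only [mannheimForm, pairing, vecMulVec_apply, finitePoint₃, dotProduct,
    Fin.sum_univ_three, cons_val_zero, cons_val_one, cons_val]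
  ring

theorem pairing_sum {ι : Type*} (s : Finset ι) (c : ι → ℂ) (X : ι → Matrix (Fin 2) (Fin 4) ℂ)
    (v : Fin 9 → ℂ) : pairing (∑ i ∈ s, c i • X i) v = ∑ i ∈ s, c i * pairing (X i) v := by
  simp only [pairing, Matrix.sum_apply, Matrix.smul_apply, smul_eq_mul, Finset.sum_mul,
    ← Finset.sum_add_distrib]
  exact Finset.sum_congr rfl fun i _ => by ring

/-- The coefficient matrices of the five normalized leg conditions. -/
def normalLeg (a₂ a₃ : ℂ) (a₄ A₅ B₅ C₅ : ℝ) : Fin 5 → Matrix (Fin 2) (Fin 4) ℂ :=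
  ![vecMulVec (finitePoint₁ 0) (finitePoint₃ 0),
    vecMulVec (finitePoint₁ a₂) (idealPoint₃ ![1, -Complex.I, 0]),
    vecMulVec (finitePoint₁ a₃) (idealPoint₃ ![1, Complex.I, 0]),
    vecMulVec (finitePoint₁ a₄) (idealPoint₃ ![0, 0, 1]),
    vecMulVec ![0, 1] (finitePoint₃ ![(A₅ : ℂ), B₅, C₅])]

theorem sum_normalLeg (a₂ a₃ : ℂ) (a₄ A₅ B₅ C₅ : ℝ) (c : Fin 5 → ℂ) :
    ∑ k, c k • normalLeg a₂ a₃ a₄ A₅ B₅ C₅ k =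
      !![c 0, c 1 + c 2, Complex.I * (c 2 - c 1), c 3;
        c 4, a₂ * c 1 + a₃ * c 2 + A₅ * c 4, Complex.I * (a₃ * c 2 - a₂ * c 1) + B₅ * c 4,
        a₄ * c 3 + C₅ * c 4] := by
  ext i j
  rw [Matrix.sum_apply, Fin.sum_univ_five]
  simp only [normalLeg, Matrix.smul_apply, cons_val_zero, cons_val_one, cons_val, vecMulVec_apply,
    finitePoint₁, finitePoint₃, idealPoint₃, smul_eq_mul, Pi.zero_apply]
  fin_cases i <;> fin_cases j <;> simp <;> ring

theorem linearIndependent_normalLeg (a₂ a₃ : ℂ) (a₄ A₅ B₅ C₅ : ℝ) :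
    LinearIndependent ℂ (normalLeg a₂ a₃ a₄ A₅ B₅ C₅) := by
  rw [Fintype.linearIndependent_iff]
  intro c hc
  rw [sum_normalLeg] at hc
  have h0 : c 0 = 0 := congrFun (congrFun hc 0) 0
  have h1 : c 1 + c 2 = 0 := congrFun (congrFun hc 0) 1
  have h2 : Complex.I * (c 2 - c 1) = 0 := congrFun (congrFun hc 0) 2
  have h3 : c 3 = 0 := congrFun (congrFun hc 0) 3
  have h4 : c 4 = 0 := congrFun (congrFun hc 1) 0
  have h5 : c 2 - c 1 = 0 := by simpa using h2
  intro i
  fin_cases i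
  · exact h0
  · change c 1 = 0
    linear_combination (h1 - h5) / 2
  · change c 2 = 0
    linear_combination (h1 + h5) / 2
  · exact h3
  · exact h4

/-- The constant terms of the five normalized leg conditions. -/
noncomputable def normalConst (R₁ p₂ p₃ p₄ p₅ : ℂ) : Fin 5 → ℂ :=
  ![-(R₁ ^ 2) / 2, p₂, p₃, p₄, p₅]

theorem mem_normalConfigurations_iff (a₂ a₃ : ℂ) (a₄ A₅ B₅ C₅ : ℝ) (R₁ p₂ p₃ p₄ p₅ : ℂ)
    (v : Fin 9 → ℂ) :
    v ∈ normalConfigurations a₂ a₃ a₄ A₅ B₅ C₅ R₁ p₂ p₃ p₄ p₅ ↔ v ∈ imageVariety ∧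
      (fun k => normalConst R₁ p₂ p₃ p₄ p₅ k * x0 v
        + pairing (normalLeg a₂ a₃ a₄ A₅ B₅ C₅ k) v) = 0 := by
  simp only [normalConfigurations, sphereForm_eq_pairing, darbouxForm_eq_pairing,
    mannheimForm_eq_pairing, Set.mem_ofPred_eq, funext_iff, Fin.forall_fin_succ,
    IsEmpty.forall_iff, and_true, Pi.zero_apply]
  have h : 1 / 2 * ((0 : ℂ) ^ 2 + (0 : Fin 3 → ℂ) ⬝ᵥ 0 - R₁ ^ 2) = -(R₁ ^ 2) / 2 := by
    rw [dotProduct_zero]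
    ring
  rw [h]
  exact Iff.rfl

end Pentapod

namespace LinearPentapod

open Pentapod

variable {P : LinearPentapod} {a₂ a₃ : ℂ} {a₄ A₅ B₅ C₅ : ℝ}

/-- The coefficients of the given leg conditions in terms of the normalized ones. -/
noncomputable def legMatrix (P : LinearPentapod) : Matrix (Fin 5) (Fin 5) ℂ :=
  -- These entries are read off from the first row and the lower left entry in `sum_normalLeg`,
  -- which already determine all five coefficients.
  Matrix.of fun i => ![1, (P.M i 0 + Complex.I * P.M i 1) / 2,
    (P.M i 0 - Complex.I * P.M i 1) / 2, P.M i 2, P.a i]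

/-- Five independent vectors lie in a span of five vectors, so dimensions force equality. In
particular the given legs are independent, too. -/
theorem Coordinatized.span_eq (h : P.Coordinatized a₂ a₃ a₄ A₅ B₅ C₅) :
    Submodule.span ℂ (Set.range (normalLeg a₂ a₃ a₄ A₅ B₅ C₅)) =
      Submodule.span ℂ (Set.range fun i : Fin 5 =>
        vecMulVec (finitePoint₁ (P.a i)) (finitePoint₃ (P.Mc i))) := by
  refine Submodule.eq_of_le_of_finrank_le (Submodule.span_le.2 ?_) ?_
  · rintro _ ⟨k, rfl⟩
    fin_cases k
    exacts [h.leg₁, h.leg₂, h.leg₃, h.leg₄, h.leg₅]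
  · rw [finrank_span_eq_card (linearIndependent_normalLeg a₂ a₃ a₄ A₅ B₅ C₅)]
    exact finrank_range_le_card _

theorem Coordinatized.corresponds_iff (h : P.Coordinatized a₂ a₃ a₄ A₅ B₅ C₅) {p : Fin 2 → ℂ}
    {q : Fin 4 → ℂ} : P.Corresponds p q ↔
      ∃ c : Fin 5 → ℂ, ∑ k, c k • normalLeg a₂ a₃ a₄ A₅ B₅ C₅ k = vecMulVec p q := by
  unfold Corresponds
  rw [← h.span_eq, Submodule.mem_span_range_iff_exists_fun]

theorem Coordinatized.leg_eq (h : P.Coordinatized a₂ a₃ a₄ A₅ B₅ C₅) (i : Fin 5) :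
    vecMulVec (finitePoint₁ (P.a i)) (finitePoint₃ (P.Mc i)) =
      ∑ k, P.legMatrix i k • normalLeg a₂ a₃ a₄ A₅ B₅ C₅ k := by
  obtain ⟨c, hc⟩ := h.corresponds_iff.1 (P.corresponds_anchor i)
  rw [← hc]
  congr 1
  ext1 k
  congr 1
  rw [sum_normalLeg] at hc
  have h0 := congrFun (congrFun hc 0) 0
  have h1 := congrFun (congrFun hc 0) 1
  have h2 := congrFun (congrFun hc 0) 2
  have h3 := congrFun (congrFun hc 0) 3
  have h4 := congrFun (congrFun hc 1) 0
  simp [vecMulVec_apply, finitePoint₁, finitePoint₃, Mc] at h0 h1 h2 h3 h4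
  have hI := Complex.I_mul_I
  fin_cases k <;> simp [legMatrix]
  · exact h0
  · linear_combination h1 / 2 + Complex.I * h2 / 2 + (c 1 - c 2) / 2 * hI
  · linear_combination h1 / 2 - Complex.I * h2 / 2 - (c 1 - c 2) / 2 * hI
  · exact h3
  · exact h4

theorem Coordinatized.exists_legMatrix_leftInverse (h : P.Coordinatized a₂ a₃ a₄ A₅ B₅ C₅) :
    ∃ T : Matrix (Fin 5) (Fin 5) ℂ, T * P.legMatrix = 1 := by
  have hT : ∀ k, ∃ c : Fin 5 → ℂ, ∑ i, c i • vecMulVec (finitePoint₁ (P.a i))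
      (finitePoint₃ (P.Mc i)) = normalLeg a₂ a₃ a₄ A₅ B₅ C₅ k := fun k => by
    rw [← Submodule.mem_span_range_iff_exists_fun, ← h.span_eq]
    exact Submodule.subset_span ⟨k, rfl⟩
  choose T hT using hT
  refine ⟨Matrix.of T, ?_⟩
  ext k l
  have hli := Fintype.linearIndependent_iff.1 (linearIndependent_normalLeg a₂ a₃ a₄ A₅ B₅ C₅)
    (fun l => (Matrix.of T * P.legMatrix) k l - (1 : Matrix (Fin 5) (Fin 5) ℂ) k l) ?_ l
  · exact sub_eq_zero.1 hli
  · simp only [sub_smul, Finset.sum_sub_distrib, Matrix.one_apply, ite_smul, one_smul, zero_smul,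
      Finset.sum_ite_eq, Finset.mem_univ, if_true, sub_eq_zero]
    rw [← hT k]
    simp only [h.leg_eq, Finset.smul_sum, smul_smul, Matrix.mul_apply, Matrix.of_apply,
      Finset.sum_smul]
    exact Finset.sum_comm

/-- Leg parameters related by the leg matrix define the same configuration set. -/
theorem Coordinatized.configurations_eq (h : P.Coordinatized a₂ a₃ a₄ A₅ B₅ C₅)
    {ρ : Fin 5 → ℂ} {R₁ p₂ p₃ p₄ p₅ : ℂ}
    (hρ : (fun i => 1 / 2 * ((P.a i : ℂ) ^ 2 + P.Mc i ⬝ᵥ P.Mc i - ρ i)) =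
      P.legMatrix *ᵥ normalConst R₁ p₂ p₃ p₄ p₅) :
    P.configurations ρ = normalConfigurations a₂ a₃ a₄ A₅ B₅ C₅ R₁ p₂ p₃ p₄ p₅ := by
  obtain ⟨T, hT⟩ := h.exists_legMatrix_leftInverse
  ext v
  rw [mem_normalConfigurations_iff]
  refine and_congr_right fun _ => ?_
  have key : (fun i => sphereForm (P.a i) (P.Mc i) (ρ i) v) = P.legMatrix *ᵥ
      (fun k => normalConst R₁ p₂ p₃ p₄ p₅ k * x0 v
        + pairing (normalLeg a₂ a₃ a₄ A₅ B₅ C₅ k) v) := by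
    ext i
    rw [sphereForm_eq_pairing, congrFun hρ i, h.leg_eq i, pairing_sum]
    simp only [mulVec, dotProduct, Finset.sum_mul, ← Finset.sum_add_distrib]
    exact Finset.sum_congr rfl fun k _ => by ring
  constructor
  · intro hv
    have h0 := key.symm.trans (funext hv)
    have := congrArg (mulVec T) h0
    rw [mulVec_mulVec, hT, one_mulVec] at this
    rw [this]
    exact mulVec_zero T
  · intro hv i
    rw [hv, mulVec_zero] at key
    exact congrFun key i

/-- The first constant is -R₁²/2, so a complex square root is all that is required. -/
theorem exists_normalConst (n : Fin 5 → ℂ) :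
    ∃ R₁ p₂ p₃ p₄ p₅ : ℂ, normalConst R₁ p₂ p₃ p₄ p₅ = n := by
  obtain ⟨R, hR⟩ := IsAlgClosed.exists_pow_nat_eq (-2 * n 0) (n := 2) two_pos
  refine ⟨R, n 1, n 2, n 3, n 4, ?_⟩
  ext k
  fin_cases k <;> simp [normalConst, hR]

theorem Coordinatized.exists_normal (h : P.Coordinatized a₂ a₃ a₄ A₅ B₅ C₅) (ρ : Fin 5 → ℂ) :
    ∃ R₁ p₂ p₃ p₄ p₅ : ℂ,
      (fun i => 1 / 2 * ((P.a i : ℂ) ^ 2 + P.Mc i ⬝ᵥ P.Mc i - ρ i)) =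
      P.legMatrix *ᵥ normalConst R₁ p₂ p₃ p₄ p₅ := by
  obtain ⟨T, hT⟩ := h.exists_legMatrix_leftInverse
  obtain ⟨R₁, p₂, p₃, p₄, p₅, hn⟩ := exists_normalConst
    (T *ᵥ fun i => 1 / 2 * ((P.a i : ℂ) ^ 2 + P.Mc i ⬝ᵥ P.Mc i - ρ i))
  refine ⟨R₁, p₂, p₃, p₄, p₅, ?_⟩
  rw [hn, mulVec_mulVec, mul_eq_one_comm.1 hT, one_mulVec]

theorem exists_sqLength (P : LinearPentapod) (R₁ p₂ p₃ p₄ p₅ : ℂ) : ∃ ρ : Fin 5 → ℂ,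
      (fun i => 1 / 2 * ((P.a i : ℂ) ^ 2 + P.Mc i ⬝ᵥ P.Mc i - ρ i)) =
      P.legMatrix *ᵥ normalConst R₁ p₂ p₃ p₄ p₅ :=
  ⟨fun i => (P.a i : ℂ) ^ 2 + P.Mc i ⬝ᵥ P.Mc i
    - 2 * (P.legMatrix *ᵥ normalConst R₁ p₂ p₃ p₄ p₅) i, by ext i; ring⟩

/-! ### Nondegeneracy of the coordinatization -/

theorem coplanar_of_linear_eq_const (f : (Fin 3 → ℝ) →ₗ[ℝ] ℝ) (hf : f ≠ 0) {c : ℝ}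
    (h : ∀ i, f (P.M i) = c) : Coplanar ℝ (Set.range P.M) := by
  have hle : vectorSpan ℝ (Set.range P.M) ≤ LinearMap.ker f := by
    rw [vectorSpan_def, Submodule.span_le]
    rintro _ ⟨_, ⟨i, rfl⟩, _, ⟨j, rfl⟩, rfl⟩
    simp [h i, h j]
  have hr : Module.finrank ℝ (LinearMap.ker f) = 2 := by
    have h1 := LinearMap.finrank_range_add_finrank_ker f
    rw [LinearMap.range_eq_top.2 (LinearMap.surjective hf)] at h1
    simp at h1
    omega
  unfold Coplanar
  rw [← Module.finrank_eq_rank]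
  exact_mod_cast (Submodule.finrank_mono hle).trans hr.le

/-- A coordinate vanishing at all new base points would place the original ones in a plane
orthogonal to the corresponding axis. -/
theorem exists_coordinate_ne_zero (hP : ¬ Coplanar ℝ (Set.range P.M)) (m : ℝ) (M₀ : Fin 3 → ℝ)
    {O : Matrix (Fin 3) (Fin 3) ℝ} (hO : Oᵀ * O = 1) (k : Fin 3) :
    ∃ i, (P.changeFrames m M₀ O).M i k ≠ 0 := by
  by_contra! h
  have hf : ((LinearMap.proj k : (Fin 3 → ℝ) →ₗ[ℝ] ℝ).comp O.mulVecLin) ≠ 0 := by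
    intro h0
    have := LinearMap.congr_fun h0 (Oᵀ *ᵥ Pi.single k 1)
    simp only [LinearMap.comp_apply, mulVecLin_apply, mulVec_mulVec, mul_eq_one_comm.1 hO,
      one_mulVec] at this
    simp at this
  refine hP (coplanar_of_linear_eq_const _ hf (c := (O *ᵥ M₀) k) fun i => ?_)
  have := h i
  simp only [changeFrames, mulVec_sub, Pi.sub_apply] at this
  simpa using sub_eq_zero.1 this

/-- A finite point of the line does not correspond to a finite and to an ideal point. -/
theorem CorrespondsSingleValued.not_finite_and_ideal (hs : P.CorrespondsSingleValued) {a : ℂ}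
    {M D : Fin 3 → ℂ} (hD : D ≠ 0) (h : P.Corresponds (finitePoint₁ a) (finitePoint₃ M))
    (h' : P.Corresponds (finitePoint₁ a) (idealPoint₃ D)) : False := by
  obtain ⟨c, hc⟩ := hs _ _ _ (finitePoint₁_ne_zero a) (idealPoint₃_ne_zero hD)
    (finitePoint₃_ne_zero _) h' h
  simpa [finitePoint₃, idealPoint₃] using congrFun hc 0

theorem Coordinatized.nondegenerate (h : P.Coordinatized a₂ a₃ a₄ A₅ B₅ C₅)
    (hs : P.CorrespondsSingleValued) (hM : ∀ k, ∃ i, P.M i k ≠ 0) :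
    a₂ ≠ 0 ∧ a₃ ≠ 0 ∧ a₄ ≠ 0 ∧ a₂ - a₄ ≠ 0 ∧ a₃ - a₄ ≠ 0 ∧
      (A₅ : ℂ) + Complex.I * B₅ ≠ 0 ∧ (A₅ : ℂ) - Complex.I * B₅ ≠ 0 ∧ C₅ ≠ 0 := by
  have hw₂ : (![1, -Complex.I, 0] : Fin 3 → ℂ) ≠ 0 := fun h => by simpa using congrFun h 0
  have hw₃ : (![1, Complex.I, 0] : Fin 3 → ℂ) ≠ 0 := fun h => by simpa using congrFun h 0
  have hw₄ : (![0, 0, 1] : Fin 3 → ℂ) ≠ 0 := fun h => by simpa using congrFun h 2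
  have hI := Complex.I_mul_I
  refine ⟨?_, ?_, ?_, ?_, ?_, ?_, ?_, ?_⟩
  · rintro rfl
    exact hs.not_finite_and_ideal hw₂ h.leg₁ h.leg₂
  · rintro rfl
    exact hs.not_finite_and_ideal hw₃ h.leg₁ h.leg₃
  · rintro rfl
    exact hs.not_finite_and_ideal hw₄ h.leg₁ (by simpa using h.leg₄)
  · intro h0
    have h2 := h.leg₂
    rw [sub_eq_zero.1 h0] at h2
    obtain ⟨c, hc⟩ := hs _ _ _ (finitePoint₁_ne_zero _) (idealPoint₃_ne_zero hw₂)
      (idealPoint₃_ne_zero hw₄) h2 h.leg₄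
    have h1 := congrFun hc 1
    have h3 := congrFun hc 3
    simp [idealPoint₃] at h1 h3
  · intro h0
    have h2 := h.leg₃
    rw [sub_eq_zero.1 h0] at h2
    obtain ⟨c, hc⟩ := hs _ _ _ (finitePoint₁_ne_zero _) (idealPoint₃_ne_zero hw₃)
      (idealPoint₃_ne_zero hw₄) h2 h.leg₄
    have h1 := congrFun hc 1
    have h3 := congrFun hc 3
    simp [idealPoint₃] at h1 h3
  · intro h0
    obtain ⟨i, hi⟩ := hM 0
    have hl := h.leg_eq i
    rw [sum_normalLeg] at hl
    have e1 := congrFun (congrFun hl 1) 1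
    have e2 := congrFun (congrFun hl 1) 2
    simp [legMatrix, vecMulVec_apply, finitePoint₁, finitePoint₃, Mc] at e1 e2
    -- Every leg satisfies (aᵢ - a₂)(Mᵢ₀ + i Mᵢ₁) = aᵢ (A₅ + i B₅). If the right side vanishes,
    -- either a finite base point and an ideal point correspond to a₂, or the real coordinate Mᵢ₀ is
    -- zero. The two remaining cases use the analogous identities.
    have e3 : ((P.a i : ℂ) - a₂) * (P.M i 0 + Complex.I * P.M i 1) = 0 := by
      linear_combination e1 + Complex.I * e2 + P.a i * h0
        + (a₃ * (P.M i 0 - Complex.I * P.M i 1) / 2 - a₂ * (P.M i 0 + Complex.I * P.M i 1) / 2) * hI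
    rcases mul_eq_zero.1 e3 with e | e
    · have := h.leg₂
      rw [← sub_eq_zero.1 e] at this
      exact hs.not_finite_and_ideal hw₂ (P.corresponds_anchor i) this
    · exact hi (by simpa using congrArg Complex.re e)
  · intro h0
    obtain ⟨i, hi⟩ := hM 0
    have hl := h.leg_eq i
    rw [sum_normalLeg] at hl
    have e1 := congrFun (congrFun hl 1) 1
    have e2 := congrFun (congrFun hl 1) 2
    simp [legMatrix, vecMulVec_apply, finitePoint₁, finitePoint₃, Mc] at e1 e2
    have e3 : ((P.a i : ℂ) - a₃) * (P.M i 0 - Complex.I * P.M i 1) = 0 := by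
      linear_combination e1 - Complex.I * e2 + P.a i * h0
        - (a₃ * (P.M i 0 - Complex.I * P.M i 1) / 2 - a₂ * (P.M i 0 + Complex.I * P.M i 1) / 2) * hI
    rcases mul_eq_zero.1 e3 with e | e
    · have := h.leg₃
      rw [← sub_eq_zero.1 e] at this
      exact hs.not_finite_and_ideal hw₃ (P.corresponds_anchor i) this
    · exact hi (by simpa using congrArg Complex.re e)
  · rintro rfl
    obtain ⟨i, hi⟩ := hM 2
    have hl := h.leg_eq i
    rw [sum_normalLeg] at hl
    have e1 := congrFun (congrFun hl 1) 3
    simp [legMatrix, vecMulVec_apply, finitePoint₁, finitePoint₃, Mc, hi] at e1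
    have := h.leg₄
    rw [← e1] at this
    exact hs.not_finite_and_ideal hw₄ (P.corresponds_anchor i) this

end LinearPentapod

/-! ### The line of squared leg lengths admitting a self-motion. -/

namespace LinearPentapod

open Pentapod

variable {P : LinearPentapod} {a₂ a₃ : ℂ} {a₄ A₅ B₅ C₅ : ℝ}

theorem quadric_coeffs_not_both_zero {a₂ a₃ : ℂ} {a₄ : ℝ} (h24 : a₂ - a₄ ≠ 0) :
    ¬ ((a₄ : ℂ) ^ 2 - a₂ * a₃ = 0 ∧ (a₄ : ℂ) - (a₂ + a₃) / 2 = 0) := by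
  rintro ⟨h1, h2⟩
  have : (a₂ - a₄) ^ 2 = 0 := by linear_combination h1 - 2 * a₂ * h2
  exact h24 (pow_eq_zero_iff two_ne_zero |>.1 this)

/-- The leg parameters of the normalized conditions that admit a self-motion. -/
theorem Coordinatized.hasSelfMotion_iff (h : P.Coordinatized a₂ a₃ a₄ A₅ B₅ C₅)
    (hs : P.CorrespondsSingleValued) (hM : ∀ k, ∃ i, P.M i k ≠ 0) (R₁ p₂ p₃ p₄ p₅ : ℂ) :
    HasSelfMotion (normalConfigurations a₂ a₃ a₄ A₅ B₅ C₅ R₁ p₂ p₃ p₄ p₅) ↔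
      (p₂ = -((A₅ * (a₂ * a₃ - a₄ ^ 2) - Complex.I * (a₂ * a₃ - a₄ ^ 2) * B₅)
          / (a₃ - a₄) ^ 2) ∧
        p₃ = -((A₅ * (a₂ * a₃ - a₄ ^ 2) + Complex.I * (a₂ * a₃ - a₄ ^ 2) * B₅)
          / (a₂ - a₄) ^ 2) ∧
        p₄ = C₅ * (a₂ * a₃ - a₄ ^ 2) / ((a₂ - a₄) * (a₃ - a₄)) ∧
        (a₂ - a₄) ^ 2 * (a₃ - a₄) ^ 2 *
            (2 * (a₂ * a₃ - a₄ ^ 2) * p₅ - (a₂ + a₃ - 2 * a₄) * R₁ ^ 2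
              - (2 * a₂ * a₃ - a₂ * a₄ - a₃ * a₄) * a₄)
          + (a₂ * a₃ - a₄ ^ 2) ^ 2 * (a₂ + a₃ - 2 * a₄)
            * ((A₅ : ℂ) ^ 2 + (B₅ : ℂ) ^ 2 + (C₅ : ℂ) ^ 2) = 0) := by
  obtain ⟨n2, n3, n4, n24, n34, nα, nα', nC⟩ := h.nondegenerate hs hM
  rw [hasSelfMotion_normal_iff_proportional n2 n3 n4 (quadric_coeffs_not_both_zero n24) nα nα' nC,
    proportional_iff n24 n34]

/-- The real affine line of solutions of a real linear equation in two unknowns, over `ℂ`. -/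
theorem linear_equation_iff {A B D : ℝ} (h : ¬ (A = 0 ∧ B = 0)) (x y : ℂ) :
    A * x + B * y + D = 0 ↔ ∃ s : ℂ, x = (-(D * A) / (A ^ 2 + B ^ 2) : ℝ) + s * B ∧
      y = (-(D * B) / (A ^ 2 + B ^ 2) : ℝ) - s * A := by
  have hn : A ^ 2 + B ^ 2 ≠ 0 := fun h0 =>
    h ⟨by nlinarith [sq_nonneg A, sq_nonneg B], by nlinarith [sq_nonneg A, sq_nonneg B]⟩
  have hn' : (A : ℂ) ^ 2 + (B : ℂ) ^ 2 ≠ 0 := by exact_mod_cast hn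
  push_cast
  constructor
  · intro he
    -- The base point is the foot of the perpendicular from the origin, and s is the coefficient
    -- along the direction (B, -A).
    refine ⟨(B * x - A * y) / (A ^ 2 + B ^ 2), ?_, ?_⟩
    · field_simp
      linear_combination A * he
    · field_simp
      linear_combination B * he
  · rintro ⟨s, rfl, rfl⟩
    field_simp
    ring

/-- The squared leg lengths that admit a self-motion form a real affine line. -/
theorem Coordinatized.exists_sqLength_line (h : P.Coordinatized a₂ a₃ a₄ A₅ B₅ C₅)
    (hs : P.CorrespondsSingleValued) (hM : ∀ k, ∃ i, P.M i k ≠ 0) (ha : ∃ i j, P.a i ≠ P.a j) :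
    ∃ ρ₀ w : Fin 5 → ℝ, w ≠ 0 ∧ ∀ ρ : Fin 5 → ℂ, HasSelfMotion (P.configurations ρ) ↔
      ∃ s : ℂ, ∀ i, ρ i = (ρ₀ i : ℂ) + s * (w i : ℂ) := by
  obtain ⟨-, -, -, n24, n34, -⟩ := h.nondegenerate hs hM
  have hI := Complex.I_mul_I
  set Z₂ := -((A₅ * (a₂ * a₃ - a₄ ^ 2) - Complex.I * (a₂ * a₃ - a₄ ^ 2) * B₅)
    / (a₃ - a₄) ^ 2) with hZ₂
  set Z₃ := -((A₅ * (a₂ * a₃ - a₄ ^ 2) + Complex.I * (a₂ * a₃ - a₄ ^ 2) * B₅)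
    / (a₂ - a₄) ^ 2) with hZ₃
  have hZ : Z₃ = starRingEnd ℂ Z₂ := by
    rw [hZ₂, hZ₃, h.conj]
    simp only [map_neg, map_div₀, map_sub, map_mul, map_pow, Complex.conj_ofReal, Complex.conj_I,
      Complex.conj_conj]
    ring
  obtain ⟨x, hx⟩ : ∃ x : ℝ, x = a₂.re := ⟨_, rfl⟩
  obtain ⟨y, hy⟩ : ∃ y : ℝ, y = a₂.im := ⟨_, rfl⟩
  have e₂ : a₂ = x + y * Complex.I := by rw [hx, hy, Complex.re_add_im]
  have e₃ : a₃ = x - y * Complex.I := by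
    rw [h.conj, e₂]
    simp only [map_add, map_mul, Complex.conj_ofReal, Complex.conj_I]
    ring
  obtain ⟨u, hu⟩ : ∃ u : ℝ, u = Z₂.re := ⟨_, rfl⟩
  obtain ⟨v, hv⟩ : ∃ v : ℝ, v = Z₂.im := ⟨_, rfl⟩
  have f₂ : Z₂ = u + v * Complex.I := by rw [hu, hv, Complex.re_add_im]
  have f₃ : Z₃ = u - v * Complex.I := by
    rw [hZ, f₂]
    simp only [map_add, map_mul, Complex.conj_ofReal, Complex.conj_I]
    ring
  -- the coefficients of the condition are real
  obtain ⟨N, hN⟩ : ∃ N : ℝ, (a₂ - a₄) * (a₃ - a₄) = (N : ℂ) := ⟨(x - a₄) ^ 2 + y ^ 2, by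
    rw [e₂, e₃]; push_cast; linear_combination -(y : ℂ) ^ 2 * hI⟩
  obtain ⟨Q, hQ⟩ : ∃ Q : ℝ, a₂ * a₃ - (a₄ : ℂ) ^ 2 = (Q : ℂ) := ⟨x ^ 2 + y ^ 2 - a₄ ^ 2, by
    rw [e₂, e₃]; push_cast; linear_combination -(y : ℂ) ^ 2 * hI⟩
  obtain ⟨τ, hτ⟩ : ∃ τ : ℝ, a₂ + a₃ - 2 * (a₄ : ℂ) = (τ : ℂ) := ⟨2 * x - 2 * a₄, by
    rw [e₂, e₃]; push_cast; ring⟩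
  have hE : 2 * a₂ * a₃ - a₂ * a₄ - a₃ * a₄ = ((2 * Q - τ * a₄ : ℝ) : ℂ) := by
    push_cast; rw [← hQ, ← hτ]; ring
  have hN0 : N ≠ 0 := by
    rintro rfl
    exact mul_ne_zero n24 n34 (by simpa using hN)
  obtain ⟨A, hA⟩ : ∃ A : ℝ, A = N ^ 2 * (2 * Q) := ⟨_, rfl⟩
  obtain ⟨B, hB⟩ : ∃ B : ℝ, B = -(N ^ 2 * τ) := ⟨_, rfl⟩
  obtain ⟨D, hD⟩ : ∃ D : ℝ, D = -(N ^ 2 * ((2 * Q - τ * a₄) * a₄))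
    + Q ^ 2 * τ * (A₅ ^ 2 + B₅ ^ 2 + C₅ ^ 2) := ⟨_, rfl⟩
  have hAB : ¬ (A = 0 ∧ B = 0) := by
    rintro ⟨hA0, hB0⟩
    have hQ0 : Q = 0 := by simpa [hA, hN0] using hA0
    have hτ0 : τ = 0 := by simpa [hB, hN0] using hB0
    rw [hQ0, Complex.ofReal_zero] at hQ
    rw [hτ0, Complex.ofReal_zero] at hτ
    exact quadric_coeffs_not_both_zero (a₃ := a₃) n24 ⟨by linear_combination -hQ, by linear_combination -hτ / 2⟩
  obtain ⟨p₀, hp₀⟩ : ∃ p₀ : ℝ, p₀ = -(D * A) / (A ^ 2 + B ^ 2) := ⟨_, rfl⟩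
  obtain ⟨r₀, hr₀⟩ : ∃ r₀ : ℝ, r₀ = -(D * B) / (A ^ 2 + B ^ 2) := ⟨_, rfl⟩
  -- Solving the leg relation for ρᵢ with (R₁², p₅) = (r₀ - sA, p₀ + sB) gives these values. The
  -- coefficient of s is -A from R₁² and -2 aᵢ B from p₅.
  refine ⟨fun i => P.a i ^ 2 + P.M i ⬝ᵥ P.M i + r₀
    - 2 * (P.M i 0 * u - P.M i 1 * v + P.M i 2 * (C₅ * Q / N) + P.a i * p₀),
    fun i => -A - 2 * P.a i * B, fun hw => ?_, fun ρ => ?_⟩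
  -- Two distinct platform coordinates force B = 0 and then A = 0.
  · obtain ⟨i, j, hij⟩ := ha
    have hi : -A - 2 * P.a i * B = 0 := congrFun hw i
    have hj : -A - 2 * P.a j * B = 0 := congrFun hw j
    have hB0 : B = 0 := by
      have : (P.a i - P.a j) * B = 0 := by linear_combination (hj - hi) / 2
      exact (mul_eq_zero.1 this).resolve_left (sub_ne_zero.2 hij)
    exact hAB ⟨by rw [hB0] at hi; linarith, hB0⟩
  · obtain ⟨T, hT⟩ := h.exists_legMatrix_leftInverse
    obtain ⟨R₁, p₂, p₃, p₄, p₅, hn⟩ := h.exists_normal ρ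
    rw [h.configurations_eq hn, h.hasSelfMotion_iff hs hM, ← hZ₂, ← hZ₃]
    have hlin : (a₂ - a₄) ^ 2 * (a₃ - a₄) ^ 2 *
          (2 * (a₂ * a₃ - a₄ ^ 2) * p₅ - (a₂ + a₃ - 2 * a₄) * R₁ ^ 2
            - (2 * a₂ * a₃ - a₂ * a₄ - a₃ * a₄) * a₄)
        + (a₂ * a₃ - a₄ ^ 2) ^ 2 * (a₂ + a₃ - 2 * a₄)
          * ((A₅ : ℂ) ^ 2 + (B₅ : ℂ) ^ 2 + (C₅ : ℂ) ^ 2) = A * p₅ + B * R₁ ^ 2 + D := by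
      rw [← mul_pow, hN, hE, hQ, hτ, hA, hB, hD]
      push_cast
      ring
    rw [hlin, linear_equation_iff hAB, hQ, hN, ← hp₀, ← hr₀]
    -- Injectivity of the leg matrix turns the parametrization of ρ into one of the normalized
    -- constants.
    have hline : ∀ s : ℂ, (∀ i, ρ i = ((P.a i ^ 2 + P.M i ⬝ᵥ P.M i + r₀
        - 2 * (P.M i 0 * u - P.M i 1 * v + P.M i 2 * (C₅ * Q / N) + P.a i * p₀) : ℝ) : ℂ)
        + s * ((-A - 2 * P.a i * B : ℝ) : ℂ)) ↔
        normalConst R₁ p₂ p₃ p₄ p₅ =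
          ![-(r₀ - s * A) / 2, Z₂, Z₃, C₅ * Q / N, p₀ + s * B] := by
      intro s
      have hinj : Function.Injective (mulVec P.legMatrix) := fun a b hab => by
        have := congrArg (mulVec T) hab
        simpa [mulVec_mulVec, hT] using this
      rw [← hinj.eq_iff, ← hn, funext_iff]
      refine forall_congr' fun i => ?_
      have hMc : P.Mc i ⬝ᵥ P.Mc i = ((P.M i ⬝ᵥ P.M i : ℝ) : ℂ) := by
        simp [dotProduct, Mc]
      rw [hMc, f₂, f₃]
      simp only [legMatrix, mulVec, dotProduct, Fin.sum_univ_five, Matrix.of_apply, cons_val_zero,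
        cons_val_one, cons_val]
      push_cast
      constructor
      · intro he
        rw [he]
        linear_combination -(P.M i 1 * v : ℂ) * hI
      · intro he
        linear_combination -2 * he - 2 * (P.M i 1 * v : ℂ) * hI
    simp only [hline]
    constructor
    · rintro ⟨rfl, rfl, rfl, s, rfl, hs'⟩
      refine ⟨s, ?_⟩
      rw [normalConst, hs']
    · rintro ⟨s, hs'⟩
      have g0 : -(R₁ ^ 2) / 2 = -(r₀ - s * A) / 2 := congrFun hs' 0
      exact ⟨congrFun hs' 1, congrFun hs' 2, congrFun hs' 3, s, congrFun hs' 4,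
        by linear_combination -2 * g0⟩

end LinearPentapod

theorem mainTheorem3 (P : LinearPentapod) (hP : P.IsTypeOne) (hD : P.Duporcq) :
    -- the squared leg lengths that admit a self-motion form a one-parameter family
    (∃ ρ₀ w : Fin 5 → ℝ, w ≠ 0 ∧
      ∀ ρ : Fin 5 → ℂ, Pentapod.HasSelfMotion (P.configurations ρ) ↔
        ∃ s : ℂ, ∀ i, ρ i = (ρ₀ i : ℂ) + s * (w i : ℂ)) ∧
    -- every real finite pair of corresponding points can serve as pair of origins
    ∀ (m : ℝ) (M₁ : Fin 3 → ℝ),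
      P.Corresponds (Pentapod.finitePoint₁ m) (Pentapod.finitePoint₃ fun k => (M₁ k : ℂ)) →
      (∃ O ∈ Matrix.specialOrthogonalGroup (Fin 3) ℝ, ∃ (a₂ a₃ : ℂ) (a₄ A₅ B₅ C₅ : ℝ),
        (P.changeFrames m M₁ O).Coordinatized a₂ a₃ a₄ A₅ B₅ C₅) ∧
      ∀ O ∈ Matrix.specialOrthogonalGroup (Fin 3) ℝ, ∀ (a₂ a₃ : ℂ) (a₄ A₅ B₅ C₅ : ℝ),
        (P.changeFrames m M₁ O).Coordinatized a₂ a₃ a₄ A₅ B₅ C₅ →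
        -- the five given legs may be replaced by the five normal conditions and conversely
        (∀ ρ : Fin 5 → ℂ, ∃ R₁ p₂ p₃ p₄ p₅ : ℂ,
          (P.changeFrames m M₁ O).configurations ρ =
            Pentapod.normalConfigurations a₂ a₃ a₄ A₅ B₅ C₅ R₁ p₂ p₃ p₄ p₅) ∧
        (∀ R₁ p₂ p₃ p₄ p₅ : ℂ, ∃ ρ : Fin 5 → ℂ,
          (P.changeFrames m M₁ O).configurations ρ =
            Pentapod.normalConfigurations a₂ a₃ a₄ A₅ B₅ C₅ R₁ p₂ p₃ p₄ p₅) ∧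
        -- the denominators below do not vanish
        a₂ - a₄ ≠ 0 ∧ a₃ - a₄ ≠ 0 ∧
        -- the leg parameters of the self-motions
        ∀ R₁ p₂ p₃ p₄ p₅ : ℂ,
          Pentapod.HasSelfMotion
            (Pentapod.normalConfigurations a₂ a₃ a₄ A₅ B₅ C₅ R₁ p₂ p₃ p₄ p₅) ↔
          (p₂ = -((A₅ * (a₂ * a₃ - a₄ ^ 2) - Complex.I * (a₂ * a₃ - a₄ ^ 2) * B₅)
              / (a₃ - a₄) ^ 2) ∧
            p₃ = -((A₅ * (a₂ * a₃ - a₄ ^ 2) + Complex.I * (a₂ * a₃ - a₄ ^ 2) * B₅)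
              / (a₂ - a₄) ^ 2) ∧
            p₄ = C₅ * (a₂ * a₃ - a₄ ^ 2) / ((a₂ - a₄) * (a₃ - a₄)) ∧
            (a₂ - a₄) ^ 2 * (a₃ - a₄) ^ 2 *
                (2 * (a₂ * a₃ - a₄ ^ 2) * p₅ - (a₂ + a₃ - 2 * a₄) * R₁ ^ 2
                  - (2 * a₂ * a₃ - a₂ * a₄ - a₃ * a₄) * a₄)
              + (a₂ * a₃ - a₄ ^ 2) ^ 2 * (a₂ + a₃ - 2 * a₄)
                * ((A₅ : ℂ) ^ 2 + (B₅ : ℂ) ^ 2 + (C₅ : ℂ) ^ 2) = 0) := by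
  have hortho : ∀ O ∈ Matrix.specialOrthogonalGroup (Fin 3) ℝ, Oᵀ * O = 1 := fun O hO =>
    mul_eq_one_comm.1 ((Matrix.mem_orthogonalGroup_iff (Fin 3) ℝ).1
      (Matrix.mem_specialOrthogonalGroup_iff.1 hO).1)
  refine ⟨?_, fun m M₁ h₁ => ⟨LinearPentapod.exists_coordinatized hP hD h₁,
    fun O hO a₂ a₃ a₄ A₅ B₅ C₅ h => ?_⟩⟩
  -- The first anchor pair is a real finite corresponding pair, and the squared leg lengths are
  -- unaffected by the change of frames.
  · obtain ⟨O, hO, a₂, a₃, a₄, A₅, B₅, C₅, h⟩ :=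
      LinearPentapod.exists_coordinatized hP hD (m := P.a 0) (M₁ := P.M 0) (P.corresponds_anchor 0)
    obtain ⟨ρ₀, w, hw, hρ⟩ := h.exists_sqLength_line (hP.singleValued.changeFrames (hortho O hO))
      (LinearPentapod.exists_coordinate_ne_zero hP.nonplanar _ _ (hortho O hO)) (by
        by_contra! hall
        have h' : ∀ i j, P.a i = P.a j := fun i j => by simpa [LinearPentapod.changeFrames] using hall i j
        exact hP.inClassP.no_three 0 1 2 (by decide) (by decide) (by decide) ⟨h' _ _, h' _ _⟩)
    refine ⟨ρ₀, w, hw, fun ρ => ?_⟩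
    rw [← hρ, LinearPentapod.hasSelfMotion_changeFrames_iff (hortho O hO)]
  · have hs := hP.singleValued.changeFrames (m := m) (M₀ := M₁) (hortho O hO)
    have hM := LinearPentapod.exists_coordinate_ne_zero hP.nonplanar m M₁ (hortho O hO)
    obtain ⟨-, -, -, n24, n34, -⟩ := h.nondegenerate hs hM
    refine ⟨fun ρ => ?_, fun R₁ p₂ p₃ p₄ p₅ => ?_, n24, n34, h.hasSelfMotion_iff hs hM⟩
    · obtain ⟨R₁, p₂, p₃, p₄, p₅, hn⟩ := h.exists_normal ρ
      exact ⟨R₁, p₂, p₃, p₄, p₅, h.configurations_eq hn⟩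
    · obtain ⟨ρ, hn⟩ := LinearPentapod.exists_sqLength (P.changeFrames m M₁ O) R₁ p₂ p₃ p₄ p₅
      exact ⟨ρ, h.configurations_eq hn⟩
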